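/- Let $M$ be a smooth ($C^\infty$, Hausdorff, finite-dimensional, without boundary) manifold, let $a>0$, and let $\{g_\varepsilon\}_{\varepsilon\in(-a,a)}$ be a $C^2$ family of pseudo-Riemannian metrics on $M$: each $g_\varepsilon$ is a field of symmetric nondegenerate bilinear forms on the tangent spaces of $M$, and the section $(\varepsilon,p)\mapsto (g_\varepsilon)_p$ of the pull-back bundle $\pi_2^*T^*M\otimes\pi_2^*T^*M$ over $(-a,a)\times M$, where $\pi_2(\varepsilon,p)=p$, is of class $C^2$. Then for every $p_0\in M$ and every $\varepsilon_0\in(0,a)$ there exists a neighborhood $U$ of $p_0$ in $M$ which is convex simultaneously for all the metrics $g_\varepsilon$ with $\varepsilon\in[-\varepsilon_0,\varepsilon_0]$. Here an open set $U\subset M$ is called convex for $g_\varepsilon$ if it is a normal neighborhood of each of its points; that is, for every $p\in U$ there is an open neighborhood $\widetilde U$ of $0$ in $T_pM$, star-shaped about $0$, on which the exponential map $\exp^\varepsilon_p$ of $g_\varepsilon$ is defined and which $\exp^\varepsilon_p$ maps $C^1$-diffeomorphically onto $U$. -/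

import Mathlib

open Set
open scoped Manifold ContDiff Bundle

noncomputable section

/-- A field of bilinear forms on the tangent spaces of the `m`-dimensional manifold `M`. -/
abbrev BilinField (m : ℕ) (M : Type*) [TopologicalSpace M]
    [ChartedSpace (EuclideanSpace ℝ (Fin m)) M] : Type _ :=
  ∀ x : M, TangentSpace (𝓡 m) x →L[ℝ] TangentSpace (𝓡 m) x →L[ℝ] ℝ

/-- Symmetry and nondegeneracy at every point: the algebraic conditions on a pseudo-Riemannian
metric. The signature is not prescribed. -/
structure IsPseudoRiemannianMetric {m : ℕ} {M : Type*} [TopologicalSpace M]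
    [ChartedSpace (EuclideanSpace ℝ (Fin m)) M] (g : BilinField m M) : Prop where
  symm : ∀ (x : M) (v w : TangentSpace (𝓡 m) x), g x v w = g x w v
  nondegenerate : ∀ (x : M) (v : TangentSpace (𝓡 m) x),
    (∀ w : TangentSpace (𝓡 m) x, g x v w = 0) → v = 0

/-- A `C²` family `g ε`, `ε ∈ (-a, a)`, of pseudo-Riemannian metrics on `M`: the assignment
`(ε, x) ↦ g ε x`, a section over `(-a, a) × M` of the pull-back of the bundle of bilinear forms on
`TM` along the projection `(ε, x) ↦ x`, is `C²`. A section of the pull-back bundle is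
encoded, as usual, by the corresponding map to the total space of the original bundle covering
the projection. The values of `g ε` for `ε` outside `(-a, a)` are irrelevant. -/
structure IsC2PseudoRiemannianFamily {m : ℕ} {M : Type*} [TopologicalSpace M]
    [ChartedSpace (EuclideanSpace ℝ (Fin m)) M] [IsManifold (𝓡 m) ∞ M]
    (a : ℝ) (g : ℝ → BilinField m M) : Prop where
  metric : ∀ ε ∈ Ioo (-a) a, IsPseudoRiemannianMetric (g ε)
  contMDiffOn : ContMDiffOn (𝓘(ℝ, ℝ).prod (𝓡 m))
    ((𝓡 m).prod 𝓘(ℝ, EuclideanSpace ℝ (Fin m) →L[ℝ] EuclideanSpace ℝ (Fin m) →L[ℝ] ℝ)) 2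
    (fun q : ℝ × M => Bundle.TotalSpace.mk'
      (EuclideanSpace ℝ (Fin m) →L[ℝ] EuclideanSpace ℝ (Fin m) →L[ℝ] ℝ)
      (E := fun x : M => TangentSpace (𝓡 m) x →L[ℝ] TangentSpace (𝓡 m) x →L[ℝ] ℝ)
      q.2 (g q.1 q.2))
    (Ioo (-a) a ×ˢ (univ : Set M))

section Coordinates

variable {m : ℕ} {M : Type*} [TopologicalSpace M] [ChartedSpace (EuclideanSpace ℝ (Fin m)) M]

/-- The coordinate vector field `∂ᵢ` of the chart `e`, at the point with coordinates `y`. -/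
def coordVector (e : OpenPartialHomeomorph M (EuclideanSpace ℝ (Fin m)))
    (y : EuclideanSpace ℝ (Fin m)) (i : Fin m) : TangentSpace (𝓡 m) (e.symm y) :=
  mfderiv (𝓡 m) (𝓡 m) e.symm y (EuclideanSpace.single i (1 : ℝ))

/-- The matrix `g_{ij} = g(∂ᵢ, ∂ⱼ)` of `g` in the chart `e`, at the point with coordinates `y`. -/
def metricMatrix (g : BilinField m M) (e : OpenPartialHomeomorph M (EuclideanSpace ℝ (Fin m)))
    (y : EuclideanSpace ℝ (Fin m)) : Matrix (Fin m) (Fin m) ℝ :=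
  Matrix.of fun i j => g (e.symm y) (coordVector e y i) (coordVector e y j)

/-- The partial derivative `∂ₗ g_{ij}` in the chart `e`. -/
def metricPartial (g : BilinField m M) (e : OpenPartialHomeomorph M (EuclideanSpace ℝ (Fin m)))
    (l i j : Fin m) (y : EuclideanSpace ℝ (Fin m)) : ℝ :=
  fderiv ℝ (fun z => metricMatrix g e z i j) y (EuclideanSpace.single l (1 : ℝ))

/-- The Christoffel symbols
`Γᵏᵢⱼ = ½ ∑ₗ gᵏˡ (∂ᵢ gⱼₗ + ∂ⱼ gᵢₗ - ∂ₗ gᵢⱼ)` of `g` in the chart `e`. -/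
def christoffel (g : BilinField m M) (e : OpenPartialHomeomorph M (EuclideanSpace ℝ (Fin m)))
    (k i j : Fin m) (y : EuclideanSpace ℝ (Fin m)) : ℝ :=
  (1 / 2 : ℝ) * ∑ l, (metricMatrix g e y)⁻¹ k l *
    (metricPartial g e i j l y + metricPartial g e j i l y - metricPartial g e l i j y)

/-- `γ` is a geodesic of `g` on the open interval `(b, c)`: it is a `C²` curve there, and in every
smooth coordinate system it satisfies `γ̈ᵏ + ∑ᵢⱼ Γᵏᵢⱼ(γ) γ̇ⁱ γ̇ʲ = 0`. -/
def IsGeodesicOn (g : BilinField m M) (γ : ℝ → M) (b c : ℝ) : Prop :=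
  ContMDiffOn 𝓘(ℝ, ℝ) (𝓡 m) 2 γ (Ioo b c) ∧
    ∀ t ∈ Ioo b c, ∀ e ∈ IsManifold.maximalAtlas (𝓡 m) ∞ M, γ t ∈ e.source →
      ∀ k : Fin m,
        deriv (deriv fun s => e (γ s) k) t +
          ∑ i, ∑ j, christoffel g e k i j (e (γ t)) *
            deriv (fun s => e (γ s) i) t * deriv (fun s => e (γ s) j) t = 0

/-- The graph of the exponential map of `g`: `exp_p v` is defined and equal to `q`, i.e. there is a
geodesic `γ`, defined on an open interval containing `[0, 1]`, with `γ 0 = p`, `γ' 0 = v` and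
`γ 1 = q`. -/
def IsExp (g : BilinField m M) (p : M) (v : TangentSpace (𝓡 m) p) (q : M) : Prop :=
  ∃ (γ : ℝ → M) (b c : ℝ), b < 0 ∧ 1 < c ∧ IsGeodesicOn g γ b c ∧
    (⟨γ 0, mfderiv 𝓘(ℝ, ℝ) (𝓡 m) γ 0 (1 : ℝ)⟩ : TangentBundle (𝓡 m) M) = ⟨p, v⟩ ∧ γ 1 = q

/-- `U` is a normal neighborhood of `p`: the exponential map at `p` is defined on an open
neighborhood of `0` in `T_p M` that is star-shaped about `0`, and it is a `C¹` diffeomorphism from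
it onto `U`. (In Mathlib the type `TangentSpace (𝓡 m) p` is by definition the model space.) -/
def IsNormalNeighborhood (g : BilinField m M) (p : M) (U : Set M) : Prop :=
  p ∈ U ∧ ∃ Φ : PartialDiffeomorph (𝓡 m) (𝓡 m) (EuclideanSpace ℝ (Fin m)) M 1,
    (0 : EuclideanSpace ℝ (Fin m)) ∈ Φ.source ∧ StarConvex ℝ 0 Φ.source ∧ Φ.target = U ∧
      ∀ v ∈ Φ.source, IsExp g p v (Φ v)

/-- `U` is (geodesically) convex for `g`: it is open and a normal neighborhood of each of
its points. -/
def IsGeodesicallyConvex (g : BilinField m M) (U : Set M) : Prop :=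
  IsOpen U ∧ ∀ p ∈ U, IsNormalNeighborhood g p U

end Coordinates

end

/-!
Everything takes place in one chart at `p₀`, where the Christoffel symbols `Γ(ε, x)` are jointly of
class `C¹`. On the compact interval `[-ε₀, ε₀]`, and after multiplication by a bump function in `x`,
they are therefore bounded by a constant `C` and Lipschitz in `x` with a constant `K` that do not
depend on `ε` (`exists_uniform_bound_lipschitz`). It is thus enough to treat a single equation
`x'' = -Γ(x)(x', x')` and to find a radius that depends on `C`, `K` and the chart only; no
dependence on parameters has to be followed.

For a starting point `p`, the equation is written for the velocity `w` as `F w = v`, with `v` the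
constant curve at the initial velocity, in the Banach space of continuous curves on `[-1, 2]`:
`F w = w + ∫ Γ(p + ∫ w)(w, w)`. The operator `F` is `C¹` because superposition with a `C¹` map is
(`contDiff_superposition`), and on a small ball it differs from the identity by a contraction. The
quantitative inverse function theorem `exists_openPartialHomeomorph_of_sub_id_lipschitz` solves
`F w = v` with `w` depending in a `C¹` way on `v`, and the same theorem, applied to
`exp_p v = p + ∫₀¹ w`, which is `v ↦ p + v` up to a contraction, shows that `exp_p` is a `C¹`
diffeomorphism of a ball onto a set containing a ball about `0` whose radius is uniform in `p`.
Since `‖x‖ ^ 2` is convex along solutions near `0` (`norm_lt_of_hasDerivAt_accel`), a solution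
joining two points of the small ball stays in it; with the homogeneity
`geodesicOperator_timeScale`, this says that the preimage of the ball under `exp_p` is star-shaped
(`exists_exponential_of_small`).

A geodesic has to satisfy its equation in every chart, whereas the construction uses one. The
geodesic equation is equivalent to the Euler–Lagrange equation
`b(x'', u) + (D_{x'} b)(x', u) - ½ (D_u b)(x', x') = 0` for all `u`, where `b` is the metric in the
chart (`geodesic_equation_iff_eulerLagrange`), and its left-hand side transforms as a covector under
changes of coordinates (`eulerLagrange_pullback`).
-/

/-! ### Superposition operators on spaces of continuous maps -/

section Superposition

variable {K : Type*} [TopologicalSpace K]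
  {E F : Type*} [NormedAddCommGroup E] [NormedAddCommGroup F]

/-- The superposition operator `u ↦ f ∘ u` on spaces of continuous functions. -/
def superposition (f : C(E, F)) (u : C(K, E)) : C(K, F) := f.comp u

@[simp]
theorem superposition_apply (f : C(E, F)) (u : C(K, E)) (t : K) :
    superposition f u t = f (u t) := rfl

theorem continuous_superposition (f : C(E, F)) :
    Continuous (superposition f : C(K, E) → C(K, F)) :=
  ContinuousMap.continuous_postcomp f

variable [CompactSpace K] [NormedSpace ℝ E] [NormedSpace ℝ F]

set_option synthInstance.maxHeartbeats 200000 in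
/-- Pointwise application of a continuous family of operators to a continuous map, as a bounded
bilinear map. -/
noncomputable def pointwiseApply :
    C(K, E →L[ℝ] F) →L[ℝ] C(K, E) →L[ℝ] C(K, F) :=
  LinearMap.mkContinuous₂
    (LinearMap.mk₂ ℝ
      (fun (A : C(K, E →L[ℝ] F)) (u : C(K, E)) => (⟨fun t => A t (u t), by fun_prop⟩ : C(K, F)))
      (fun A B u => by ext; rfl) (fun c A u => by ext; rfl)
      (fun A u v => by ext; simp) (fun c A u => by ext; simp)) 1 (fun A u => by
    rw [ContinuousMap.norm_le _ (by positivity)]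
    intro t
    have h := (A t).le_opNorm (u t)
    have h1 := A.norm_coe_le_norm t
    have h2 := u.norm_coe_le_norm t
    simp only [LinearMap.mk₂_apply, ContinuousMap.coe_mk, one_mul]
    exact h.trans (by gcongr))

/-- The superposition operator of a `C¹` map is differentiable, and its derivative is pointwise
application of the derivative of the map. -/
theorem hasFDerivAt_superposition (f : C(E, F)) (f' : C(E, E →L[ℝ] F))
    (hf : ∀ x, HasFDerivAt f (f' x) x) (u : C(K, E)) :
    HasFDerivAt (superposition f : C(K, E) → C(K, F))
      (pointwiseApply (superposition f' u)) u := by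
  rw [hasFDerivAt_iff_isLittleO_nhds_zero, Asymptotics.isLittleO_iff]
  intro ε hε
  have hc := (continuous_superposition (K := K) f').continuousAt (x := u)
  obtain ⟨δ, hδ, hδε⟩ := Metric.continuousAt_iff.1 hc ε hε
  filter_upwards [Metric.ball_mem_nhds (0 : C(K, E)) hδ] with h hh
  rw [mem_ball_zero_iff] at hh
  rw [ContinuousMap.norm_le _ (by positivity)]
  intro t
  -- The mean value inequality on the segment from `u t` to `u t + h t`; each of its points is a
  -- value at `t` of a curve that is uniformly `δ`-close to `u`.
  have key : ∀ x ∈ segment ℝ (u t) (u t + h t), ‖f' x - f' (u t)‖ ≤ ε := by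
    intro x hx
    rw [segment_eq_image'] at hx
    obtain ⟨θ, hθ, rfl⟩ := hx
    have h1 : dist (u + θ • h) u < δ := by
      rw [dist_eq_norm, add_sub_cancel_left, norm_smul, Real.norm_of_nonneg hθ.1]
      exact (mul_le_of_le_one_left (norm_nonneg _) hθ.2).trans_lt hh
    have h2 := (ContinuousMap.dist_lt_iff hε).1 (hδε h1) t
    rw [dist_eq_norm] at h2
    simpa using h2.le
  have := (convex_segment (u t) (u t + h t)).norm_image_sub_le_of_norm_hasFDerivWithin_le'
    (f := f) (f' := fun x => f' x) (φ := f' (u t)) (C := ε)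
    (fun x _ => (hf x).hasFDerivWithinAt) key (left_mem_segment ℝ _ _) (right_mem_segment ℝ _ _)
  simp only [add_sub_cancel_left] at this
  exact this.trans (mul_le_mul_of_nonneg_left (h.norm_coe_le_norm t) hε.le)

theorem contDiff_superposition (f : C(E, F)) (hf : ContDiff ℝ 1 f) :
    ContDiff ℝ 1 (superposition f : C(K, E) → C(K, F)) := by
  obtain ⟨hd, hc⟩ := contDiff_one_iff_fderiv.1 hf
  let f' : C(E, E →L[ℝ] F) := ⟨fderiv ℝ f, hc⟩
  have h := hasFDerivAt_superposition (K := K) f f' fun x => (hd x).hasFDerivAt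
  rw [contDiff_one_iff_fderiv]
  refine ⟨fun u => (h u).differentiableAt, ?_⟩
  have : fderiv ℝ (superposition f : C(K, E) → C(K, F)) =
      fun u => pointwiseApply (superposition f' u) := funext fun u => (h u).fderiv
  rw [this]
  exact pointwiseApply.continuous.comp (continuous_superposition f')

end Superposition

/-! ### Perturbations of the identity -/

section Perturbation

variable {X : Type*} [NormedAddCommGroup X] [NormedSpace ℝ X] [CompleteSpace X]

/-- A quantitative inverse function theorem: a `C¹` map that differs from the identity by a
strict contraction on a ball is a `C¹` diffeomorphism of that ball onto an open set, and the
image contains a ball of an explicit radius. -/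
theorem exists_openPartialHomeomorph_of_sub_id_lipschitz (f : X → X) (ρ : ℝ) (c : ℝ) (hc0 : 0 ≤ c)
    (hc : c < 1)
    (hf : ∀ x ∈ Metric.ball (0 : X) ρ, ∀ y ∈ Metric.ball (0 : X) ρ,
      ‖f x - f y - (x - y)‖ ≤ c * ‖x - y‖)
    (hd : ContDiffOn ℝ 1 f (Metric.ball 0 ρ)) :
    ∃ Φ : OpenPartialHomeomorph X X, Φ.source = Metric.ball 0 ρ ∧ (∀ x, Φ x = f x) ∧
      Metric.ball (f 0) ((1 - c) * ρ) ⊆ Φ.target ∧ ContDiffOn ℝ 1 Φ.symm Φ.target := by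
  have hA : ApproximatesLinearOn f ((ContinuousLinearEquiv.refl ℝ X : X ≃L[ℝ] X) : X →L[ℝ] X)
      (Metric.ball 0 ρ) ⟨c, hc0⟩ := fun x hx y hy => hf x hx y hy
  have hN : Subsingleton X ∨
      (⟨c, hc0⟩ : NNReal) < ‖((ContinuousLinearEquiv.refl ℝ X).symm : X →L[ℝ] X)‖₊⁻¹ := by
    rcases subsingleton_or_nontrivial X with h | h
    · exact Or.inl h
    · right
      have : ‖((ContinuousLinearEquiv.refl ℝ X).symm : X →L[ℝ] X)‖₊ = 1 := by
        have : ((ContinuousLinearEquiv.refl ℝ X).symm : X →L[ℝ] X) = ContinuousLinearMap.id ℝ X :=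
          rfl
        rw [this]
        exact NNReal.eq (by simp)
      rw [this, inv_one]
      exact hc
  let Φ := hA.toOpenPartialHomeomorph f _ hN Metric.isOpen_ball
  have hΦ : ∀ x, Φ x = f x := fun _ => rfl
  have hsrc : Φ.source = Metric.ball 0 ρ := rfl
  refine ⟨Φ, hsrc, hΦ, ?_, ?_⟩
  · intro y hy
    have hρ : 0 < ρ := by
      have h1 : 0 < (1 - c) * ρ := Metric.pos_of_mem_ball hy
      have h2 : 0 < 1 - c := by linarith
      exact (pos_iff_pos_of_mul_pos h1).1 h2
    let R : (((ContinuousLinearEquiv.refl ℝ X : X ≃L[ℝ] X) : X →L[ℝ] X)).NonlinearRightInverse :=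
      { toFun := id, nnnorm := 1, bound' := fun y => by simp, right_inv' := fun y => rfl }
    -- A closed ball, slightly smaller, whose image already contains `y`.
    obtain ⟨σ, hσ0, hσρ, hσ⟩ : ∃ σ, 0 ≤ σ ∧ σ < ρ ∧ dist y (f 0) ≤ (1 - c) * σ := by
      refine ⟨dist y (f 0) / (1 - c), ?_, ?_, ?_⟩
      · have : 0 < 1 - c := by linarith
        positivity
      · rw [div_lt_iff₀ (by linarith), mul_comm]
        exact hy
      · rw [mul_div_cancel₀]
        linarith
    have := hA.surjOn_closedBall_of_nonlinearRightInverse R hσ0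
      (Metric.closedBall_subset_ball (x := (0 : X)) hσρ)
    have hy' : y ∈ Metric.closedBall (f 0) (((R.nnnorm : ℝ)⁻¹ - ((⟨c, hc0⟩ : NNReal) : ℝ)) * σ) := by
      simpa [R] using hσ
    obtain ⟨x, hx, rfl⟩ := this hy'
    exact Φ.map_source (Metric.closedBall_subset_ball hσρ hx)
  · intro y hy
    have hx : Φ.symm y ∈ Metric.ball (0 : X) ρ := Φ.map_target hy
    set x := Φ.symm y with hxdef
    have hnhds : Metric.ball (0 : X) ρ ∈ nhds x := Metric.isOpen_ball.mem_nhds hx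
    have hfx : ContDiffAt ℝ 1 f x := hd.contDiffAt hnhds
    have hder : HasFDerivAt f (fderiv ℝ f x) x :=
      (hfx.differentiableAt one_ne_zero).hasFDerivAt
    -- The derivative is at distance at most `c < 1` from the identity, hence invertible.
    have hnorm : ‖fderiv ℝ f x - ContinuousLinearMap.id ℝ X‖ ≤ c := by
      have h1 := (hder.sub (hasFDerivAt_id x)).le_of_lipschitzOn hnhds
        (C := ⟨c, hc0⟩) (lipschitzOnWith_iff_norm_sub_le.2 fun a ha b hb => by
          have := hf a ha b hb
          have h3 : (f a - a) - (f b - b) = f a - f b - (a - b) := by abel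
          exact h3 ▸ this)
      exact h1
    let u : (X →L[ℝ] X)ˣ := Units.oneSub (ContinuousLinearMap.id ℝ X - fderiv ℝ f x)
      (by rw [norm_sub_rev]; exact hnorm.trans_lt hc)
    let A : X ≃L[ℝ] X := ContinuousLinearEquiv.unitsEquiv ℝ X u
    have hAf : (A : X →L[ℝ] X) = fderiv ℝ f x := by
      ext z
      change ((1 : X →L[ℝ] X) - (ContinuousLinearMap.id ℝ X - fderiv ℝ f x)) z = _
      simp
    have := Φ.contDiffAt_symm (n := 1) (f₀' := A) hy (by rw [hAf]; exact hder) hfx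
    exact this.contDiffWithinAt

end Perturbation

/-! ### Primitives of curves on `[-1, 2]` -/

section Primitive

variable {E : Type*} [NormedAddCommGroup E]

/-- The continuous extension to `ℝ`, constant outside of `[-1, 2]`, of a curve defined on the
interval `[-1, 2]`. -/
noncomputable def curveExtend (u : C(Icc (-1 : ℝ) 2, E)) : ℝ → E :=
  IccExtend (by norm_num : (-1 : ℝ) ≤ 2) u

theorem continuous_curveExtend (u : C(Icc (-1 : ℝ) 2, E)) : Continuous (curveExtend u) :=
  u.continuous.Icc_extend'

theorem curveExtend_of_mem (u : C(Icc (-1 : ℝ) 2, E)) {t : ℝ} (ht : t ∈ Icc (-1 : ℝ) 2) :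
    curveExtend u t = u ⟨t, ht⟩ := IccExtend_of_mem _ _ ht

theorem norm_curveExtend_le (u : C(Icc (-1 : ℝ) 2, E)) (t : ℝ) : ‖curveExtend u t‖ ≤ ‖u‖ :=
  u.norm_coe_le_norm _

theorem intervalIntegrable_curveExtend (u : C(Icc (-1 : ℝ) 2, E)) (a b : ℝ) :
    IntervalIntegrable (curveExtend u) MeasureTheory.volume a b :=
  (continuous_curveExtend u).intervalIntegrable _ _

variable [NormedSpace ℝ E]

theorem norm_integral_curveExtend_le (u : C(Icc (-1 : ℝ) 2, E)) (t : ℝ) :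
    ‖∫ s in (0 : ℝ)..t, curveExtend u s‖ ≤ |t| * ‖u‖ := by
  have := intervalIntegral.norm_integral_le_of_norm_le_const (a := 0) (b := t) (C := ‖u‖)
    (f := curveExtend u) fun s _ => norm_curveExtend_le u s
  simpa [mul_comm] using this

/-- The primitive vanishing at time `0`, as a bounded operator on the space of continuous curves on
`[-1, 2]`. -/
noncomputable def primitive : C(Icc (-1 : ℝ) 2, E) →L[ℝ] C(Icc (-1 : ℝ) 2, E) :=
  LinearMap.mkContinuous
    { toFun := fun u => ⟨fun t => ∫ s in (0 : ℝ)..t, curveExtend u s,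
        (intervalIntegral.continuous_primitive (intervalIntegrable_curveExtend u) 0).comp
          continuous_subtype_val⟩
      map_add' := fun u v => by
        ext t
        exact intervalIntegral.integral_add (intervalIntegrable_curveExtend u _ _)
          (intervalIntegrable_curveExtend v _ _)
      map_smul' := fun c u => by
        ext t
        exact intervalIntegral.integral_smul c (curveExtend u) } 2 fun u => by
    rw [ContinuousMap.norm_le _ (by positivity)]
    intro t
    refine (norm_integral_curveExtend_le u t).trans ?_
    gcongr
    exact abs_le.2 ⟨by linarith [t.2.1], t.2.2⟩

theorem primitive_apply (u : C(Icc (-1 : ℝ) 2, E)) (t : Icc (-1 : ℝ) 2) :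
    primitive u t = ∫ s in (0 : ℝ)..t, curveExtend u s := rfl

theorem norm_primitive_le (u : C(Icc (-1 : ℝ) 2, E)) : ‖primitive u‖ ≤ 2 * ‖u‖ :=
  (primitive (E := E)).le_of_opNorm_le (by
    unfold primitive
    exact LinearMap.mkContinuous_norm_le _ (by norm_num) _) u

theorem primitive_zero (h : (0 : ℝ) ∈ Icc (-1 : ℝ) 2) (u : C(Icc (-1 : ℝ) 2, E)) :
    primitive u ⟨0, h⟩ = 0 := by
  simp [primitive_apply]

theorem hasDerivAt_curveExtend_primitive [CompleteSpace E] (u : C(Icc (-1 : ℝ) 2, E)) {t : ℝ}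
    (ht : t ∈ Ioo (-1 : ℝ) 2) :
    HasDerivAt (curveExtend (primitive u)) (curveExtend u t) t := by
  have h := (continuous_curveExtend u).integral_hasStrictDerivAt 0 t
  refine h.hasDerivAt.congr_of_eventuallyEq ?_
  filter_upwards [Ioo_mem_nhds ht.1 ht.2] with s hs
  rw [curveExtend_of_mem _ (Ioo_subset_Icc_self hs), primitive_apply]

/-- The time change `t ↦ τ t` of `[-1, 2]`, for `τ ∈ [0, 1]`. -/
def timeScale (τ : ℝ) (hτ : τ ∈ Icc (0 : ℝ) 1) : C(Icc (-1 : ℝ) 2, Icc (-1 : ℝ) 2) where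
  toFun t := ⟨τ * t, by
    obtain ⟨t, ht⟩ := t
    constructor <;> nlinarith [hτ.1, hτ.2, ht.1, ht.2]⟩
  continuous_toFun := by fun_prop

/-- Substitution `s ↦ τ s` in a primitive. -/
theorem primitive_smul_comp_timeScale (τ : ℝ) (hτ : τ ∈ Icc (0 : ℝ) 1)
    (u : C(Icc (-1 : ℝ) 2, E)) :
    primitive (τ • u.comp (timeScale τ hτ)) = (primitive u).comp (timeScale τ hτ) := by
  ext t
  rw [map_smul]
  change τ • (∫ s in (0 : ℝ)..t, curveExtend (u.comp (timeScale τ hτ)) s) =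
    ∫ s in (0 : ℝ)..(τ * t), curveExtend u s
  have : (∫ s in (0 : ℝ)..t, curveExtend (u.comp (timeScale τ hτ)) s) =
      ∫ s in (0 : ℝ)..t, curveExtend u (τ * s) := by
    apply intervalIntegral.integral_congr
    intro s hs
    have hs' : s ∈ Icc (-1 : ℝ) 2 :=
      (uIcc_subset_Icc (by norm_num) t.2) hs
    change curveExtend (u.comp (timeScale τ hτ)) s = curveExtend u (τ * s)
    rw [curveExtend_of_mem _ hs']
    exact (curveExtend_of_mem u (timeScale τ hτ ⟨s, hs'⟩).2).symm
  rw [this, intervalIntegral.smul_integral_comp_mul_left, mul_zero]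

end Primitive

/-! ### The geodesic equation as an operator equation for the velocity -/

section GeodesicOperator

set_option synthInstance.maxHeartbeats 200000

variable {E : Type*} [NormedAddCommGroup E] [NormedSpace ℝ E]

/-- The quadratic acceleration term `t ↦ Γ(x t)(w t, w t)`, where `x` is the curve with velocity `w`
issuing from `p`. -/
noncomputable def accelTerm (Γ : C(E, E →L[ℝ] E →L[ℝ] E)) (p : E) (w : C(Icc (-1 : ℝ) 2, E)) :
    C(Icc (-1 : ℝ) 2, E) :=
  pointwiseApply (pointwiseApply
    (superposition Γ (ContinuousMap.const _ p + primitive w)) w) w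

theorem accelTerm_apply (Γ : C(E, E →L[ℝ] E →L[ℝ] E)) (p : E) (w : C(Icc (-1 : ℝ) 2, E))
    (t : Icc (-1 : ℝ) 2) :
    accelTerm Γ p w t = Γ (p + primitive w t) (w t) (w t) := rfl

theorem contDiff_superposition_primitive {F : Type*} [NormedAddCommGroup F] [NormedSpace ℝ F]
    (f : C(E, F)) (hf : ContDiff ℝ 1 f) (p : E) :
    ContDiff ℝ 1 fun w : C(Icc (-1 : ℝ) 2, E) =>
      superposition f (ContinuousMap.const _ p + primitive w) := by
  have h : ContDiff ℝ 1 fun w : C(Icc (-1 : ℝ) 2, E) =>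
      ContinuousMap.const (Icc (-1 : ℝ) 2) p + primitive w :=
    contDiff_const.add (primitive (E := E)).contDiff
  have h' := contDiff_superposition (K := Icc (-1 : ℝ) 2) f hf
  exact h'.comp h

theorem contDiff_pointwiseApply {K X F G : Type*} [TopologicalSpace K] [CompactSpace K]
    [NormedAddCommGroup X] [NormedSpace ℝ X] [NormedAddCommGroup F] [NormedSpace ℝ F]
    [NormedAddCommGroup G] [NormedSpace ℝ G] {A : X → C(K, F →L[ℝ] G)} {u : X → C(K, F)}
    (hA : ContDiff ℝ 1 A) (hu : ContDiff ℝ 1 u) :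
    ContDiff ℝ 1 fun x => pointwiseApply (A x) (u x) := by
  have hL : ContDiff ℝ 1 fun B : C(K, F →L[ℝ] G) => pointwiseApply B :=
    ContinuousLinearMap.contDiff _
  have h : ContDiff ℝ 1 fun x => pointwiseApply (A x) := hL.comp hA
  exact h.clm_apply hu

theorem contDiff_accelTerm (Γ : C(E, E →L[ℝ] E →L[ℝ] E)) (hΓ : ContDiff ℝ 1 Γ) (p : E) :
    ContDiff ℝ 1 (accelTerm Γ p) := by
  have h1 := contDiff_superposition_primitive (F := E →L[ℝ] E →L[ℝ] E) Γ hΓ p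
  have h2 := contDiff_pointwiseApply (F := E) (G := E →L[ℝ] E) h1 contDiff_id
  exact contDiff_pointwiseApply (F := E) (G := E) h2 contDiff_id

/-- The operator whose value is constant, equal to `v`, exactly at the velocity `w` of the solution
of `x'' + Γ(x)(x', x') = 0`, `x 0 = p`, `x' 0 = v`. -/
noncomputable def geodesicOperator (Γ : C(E, E →L[ℝ] E →L[ℝ] E)) (p : E)
    (w : C(Icc (-1 : ℝ) 2, E)) : C(Icc (-1 : ℝ) 2, E) :=
  w + primitive (accelTerm Γ p w)

theorem contDiff_geodesicOperator (Γ : C(E, E →L[ℝ] E →L[ℝ] E)) (hΓ : ContDiff ℝ 1 Γ) (p : E) :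
    ContDiff ℝ 1 (geodesicOperator Γ p) :=
  contDiff_id.add ((primitive (E := E)).contDiff.comp (contDiff_accelTerm Γ hΓ p))

theorem geodesicOperator_zero (Γ : C(E, E →L[ℝ] E →L[ℝ] E)) (p : E) :
    geodesicOperator Γ p 0 = 0 := by
  have : accelTerm Γ p 0 = 0 := by
    ext t
    simp [accelTerm_apply]
  rw [geodesicOperator, this, map_zero, add_zero]

/-- Homogeneity of geodesics: running a solution at `τ` times its speed multiplies the initial
velocity by `τ`. -/
theorem geodesicOperator_timeScale (Γ : C(E, E →L[ℝ] E →L[ℝ] E)) (p : E) (τ : ℝ)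
    (hτ : τ ∈ Icc (0 : ℝ) 1) (w : C(Icc (-1 : ℝ) 2, E)) :
    geodesicOperator Γ p (τ • w.comp (timeScale τ hτ)) =
      τ • (geodesicOperator Γ p w).comp (timeScale τ hτ) := by
  have h : accelTerm Γ p (τ • w.comp (timeScale τ hτ)) =
      τ • (τ • (accelTerm Γ p w).comp (timeScale τ hτ)) := by
    ext t
    have := DFunLike.congr_fun (primitive_smul_comp_timeScale τ hτ w) t
    rw [accelTerm_apply, this]
    simp [accelTerm_apply]
  rw [geodesicOperator, h, map_smul, primitive_smul_comp_timeScale, ← smul_add]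
  rfl

/-- Being quadratic in the velocity, the acceleration term has a small Lipschitz constant on small
balls. -/
theorem norm_accelTerm_sub_le (Γ : C(E, E →L[ℝ] E →L[ℝ] E)) {C K σ : ℝ} (hC : 0 ≤ C) (hK : 0 ≤ K)
    (hΓC : ∀ x, ‖Γ x‖ ≤ C) (hΓK : ∀ x y, ‖Γ x - Γ y‖ ≤ K * ‖x - y‖) (p : E)
    (w₁ w₂ : C(Icc (-1 : ℝ) 2, E)) (h₁ : ‖w₁‖ ≤ σ) (h₂ : ‖w₂‖ ≤ σ) :
    ‖accelTerm Γ p w₁ - accelTerm Γ p w₂‖ ≤ (2 * K * σ ^ 2 + 2 * C * σ) * ‖w₁ - w₂‖ := by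
  have hσ : 0 ≤ σ := (norm_nonneg _).trans h₁
  rw [ContinuousMap.norm_le _ (by positivity)]
  intro t
  rw [ContinuousMap.sub_apply, accelTerm_apply, accelTerm_apply]
  set x₁ := p + primitive w₁ t
  set x₂ := p + primitive w₂ t
  have hx : ‖x₁ - x₂‖ ≤ 2 * ‖w₁ - w₂‖ := by
    have h := norm_primitive_le (w₁ - w₂)
    have h' := (primitive (w₁ - w₂)).norm_coe_le_norm t
    rw [map_sub, ContinuousMap.sub_apply, ← map_sub] at h'
    have : x₁ - x₂ = primitive w₁ t - primitive w₂ t := add_sub_add_left_eq_sub _ _ _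
    rw [this]
    exact h'.trans h
  have ha := (w₁.norm_coe_le_norm t).trans h₁
  have hb := (w₂.norm_coe_le_norm t).trans h₂
  have hd : ‖w₁ t - w₂ t‖ ≤ ‖w₁ - w₂‖ := (w₁ - w₂).norm_coe_le_norm t
  have split : Γ x₁ (w₁ t) (w₁ t) - Γ x₂ (w₂ t) (w₂ t) =
      (Γ x₁ - Γ x₂) (w₁ t) (w₁ t) + Γ x₂ (w₁ t - w₂ t) (w₁ t) + Γ x₂ (w₂ t) (w₁ t - w₂ t) := by
    simp only [map_sub, sub_apply]
    abel
  rw [split]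
  have e1 : ‖(Γ x₁ - Γ x₂) (w₁ t) (w₁ t)‖ ≤ K * (2 * ‖w₁ - w₂‖) * σ * σ := by
    refine ((Γ x₁ - Γ x₂).le_opNorm₂ _ _).trans ?_
    have := (hΓK x₁ x₂).trans (mul_le_mul_of_nonneg_left hx hK)
    gcongr
  have e2 : ‖Γ x₂ (w₁ t - w₂ t) (w₁ t)‖ ≤ C * ‖w₁ - w₂‖ * σ := by
    refine ((Γ x₂).le_opNorm₂ _ _).trans ?_
    have := hΓC x₂
    gcongr
  have e3 : ‖Γ x₂ (w₂ t) (w₁ t - w₂ t)‖ ≤ C * σ * ‖w₁ - w₂‖ := by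
    refine ((Γ x₂).le_opNorm₂ _ _).trans ?_
    have := hΓC x₂
    gcongr
  calc _ ≤ K * (2 * ‖w₁ - w₂‖) * σ * σ + C * ‖w₁ - w₂‖ * σ + C * σ * ‖w₁ - w₂‖ :=
        (norm_add₃_le).trans (add_le_add (add_le_add e1 e2) e3)
    _ = _ := by ring

end GeodesicOperator

/-! ### Exponential maps with uniform domains -/

section UniformExponential

variable {E : Type*} [NormedAddCommGroup E] [InnerProductSpace ℝ E]

set_option synthInstance.maxHeartbeats 200000

/-- A solution of `x'' = -Γ(x)(x', x')` that stays where `‖x‖ ‖Γ‖ ≤ 1` cannot leave a ball centred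
at `0` between two points of it, because `‖x‖ ^ 2` is a convex function of time. -/
theorem norm_lt_of_hasDerivAt_accel {Γ : E → E →L[ℝ] E →L[ℝ] E} {C R r : ℝ}
    (_hC : 0 ≤ C) (hΓC : ∀ x, ‖Γ x‖ ≤ C) (hRC : R * C ≤ 1) {x w : ℝ → E}
    (hR : ∀ t ∈ Ioo (-1 : ℝ) 2, ‖x t‖ ≤ R)
    (hx : ∀ t ∈ Ioo (-1 : ℝ) 2, HasDerivAt x (w t) t)
    (hw : ∀ t ∈ Ioo (-1 : ℝ) 2, HasDerivAt w (-Γ (x t) (w t) (w t)) t)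
    (h0 : ‖x 0‖ < r) (h1 : ‖x 1‖ < r) {t : ℝ} (ht : t ∈ Icc (0 : ℝ) 1) : ‖x t‖ < r := by
  have hconv : ConvexOn ℝ (Ioo (-1 : ℝ) 2) fun t => inner ℝ (x t) (x t) := by
    refine convexOn_of_hasDerivWithinAt2_nonneg (convex_Ioo _ _)
      (f' := fun t => 2 * inner ℝ (x t) (w t))
      (f'' := fun t => 2 * (inner ℝ (x t) (-Γ (x t) (w t) (w t)) + inner ℝ (w t) (w t)))
      ?_ ?_ ?_ ?_
    · exact fun t ht => ((hx t ht).inner ℝ (hx t ht)).continuousAt.continuousWithinAt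
    · rw [interior_Ioo]
      intro t ht
      have := (hx t ht).inner ℝ (hx t ht)
      refine HasDerivAt.hasDerivWithinAt ?_
      convert! this using 1
      rw [real_inner_comm (x t) (w t)]
      ring
    · rw [interior_Ioo]
      intro t ht
      exact (((hx t ht).inner ℝ (hw t ht)).const_mul 2).hasDerivWithinAt
    · rw [interior_Ioo]
      intro t ht
      have e1 : inner ℝ (x t) (Γ (x t) (w t) (w t)) ≤ ‖w t‖ ^ 2 := by
        calc inner ℝ (x t) (Γ (x t) (w t) (w t)) ≤ ‖x t‖ * ‖Γ (x t) (w t) (w t)‖ :=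
              real_inner_le_norm _ _
          _ ≤ R * (C * ‖w t‖ * ‖w t‖) := by
              have a1 := hR t ht
              have a2 : ‖Γ (x t) (w t) (w t)‖ ≤ C * ‖w t‖ * ‖w t‖ := by
                refine ((Γ (x t)).le_opNorm₂ _ _).trans ?_
                have := hΓC (x t)
                gcongr
              have a3 : 0 ≤ R := (norm_nonneg _).trans a1
              gcongr
          _ = (R * C) * ‖w t‖ ^ 2 := by ring
          _ ≤ 1 * ‖w t‖ ^ 2 := by gcongr
          _ = _ := one_mul _
      rw [inner_neg_right, real_inner_self_eq_norm_sq]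
      linarith
  have := hconv.le_max_of_mem_Icc (x := 0) (y := 1) (z := t) (by norm_num) (by norm_num) ht
  simp only [real_inner_self_eq_norm_sq] at this
  have hr : 0 < r := (norm_nonneg _).trans_lt h0
  refine lt_of_pow_lt_pow_left₀ 2 hr.le (this.trans_lt (max_lt ?_ ?_))
  · gcongr
  · gcongr

variable [CompleteSpace E]

/-- Uniform existence of convex balls for `x'' = -Γ(x)(x', x')`: if the bound `C` and the Lipschitz
constant `K` of `Γ` are small compared with `σ⁻¹`, then the ball of radius `σ / 6` about `0` is a
normal neighborhood of each of its points `p`. -/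
theorem exists_exponential_of_small (Γ : C(E, E →L[ℝ] E →L[ℝ] E)) (hΓ : ContDiff ℝ 1 Γ)
    {C K σ : ℝ} (hC : 0 ≤ C) (hK : 0 ≤ K)
    (hΓC : ∀ x, ‖Γ x‖ ≤ C) (hΓK : ∀ x y, ‖Γ x - Γ y‖ ≤ K * ‖x - y‖)
    (hσ : 0 < σ) (hsmall : 2 * (2 * K * σ ^ 2 + 2 * C * σ) ≤ 1 / 4)
    (p : E) (hp : p ∈ Metric.ball (0 : E) (σ / 6)) :
    ∃ Θ : OpenPartialHomeomorph E E, (0 : E) ∈ Θ.source ∧ StarConvex ℝ 0 Θ.source ∧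
      Θ.target = Metric.ball 0 (σ / 6) ∧ ContDiffOn ℝ 1 Θ Θ.source ∧
      ContDiffOn ℝ 1 Θ.symm Θ.target ∧ ∀ v ∈ Θ.source, ∃ x w : ℝ → E,
        x 0 = p ∧ w 0 = v ∧ x 1 = Θ v ∧ ∀ t ∈ Ioo (-1 : ℝ) 2, ‖x t‖ < 3 * σ ∧
          HasDerivAt x (w t) t ∧ HasDerivAt w (-Γ (x t) (w t) (w t)) t := by
  have hp' : ‖p‖ < σ / 6 := mem_ball_zero_iff.1 hp
  have m0 : (0 : ℝ) ∈ Icc (-1 : ℝ) 2 := by norm_num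
  have m1 : (1 : ℝ) ∈ Icc (-1 : ℝ) 2 := by norm_num
  set F := geodesicOperator Γ p with hFdef
  have hacc : ∀ w₁ ∈ Metric.ball (0 : C(Icc (-1 : ℝ) 2, E)) σ,
      ∀ w₂ ∈ Metric.ball (0 : C(Icc (-1 : ℝ) 2, E)) σ,
      ‖F w₁ - F w₂ - (w₁ - w₂)‖ ≤ 1 / 4 * ‖w₁ - w₂‖ := by
    intro w₁ h₁ w₂ h₂
    rw [mem_ball_zero_iff] at h₁ h₂
    have e : F w₁ - F w₂ - (w₁ - w₂) = primitive (accelTerm Γ p w₁ - accelTerm Γ p w₂) := by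
      rw [map_sub, hFdef, geodesicOperator, geodesicOperator]
      abel
    rw [e]
    calc _ ≤ 2 * ‖accelTerm Γ p w₁ - accelTerm Γ p w₂‖ := norm_primitive_le _
      _ ≤ 2 * ((2 * K * σ ^ 2 + 2 * C * σ) * ‖w₁ - w₂‖) := by
          gcongr
          exact norm_accelTerm_sub_le Γ hC hK hΓC hΓK p w₁ w₂ h₁.le h₂.le
      _ = 2 * (2 * K * σ ^ 2 + 2 * C * σ) * ‖w₁ - w₂‖ := by ring
      _ ≤ _ := by gcongr
  have hF0 : F 0 = 0 := geodesicOperator_zero Γ p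
  obtain ⟨Ψ, hΨs, hΨ, hΨt, hΨd⟩ := exists_openPartialHomeomorph_of_sub_id_lipschitz F σ (1 / 4)
    (by norm_num) (by norm_num) hacc (contDiff_geodesicOperator Γ hΓ p).contDiffOn
  rw [hF0] at hΨt
  -- The velocity curve as a function of the initial velocity.
  let cst : E →L[ℝ] C(Icc (-1 : ℝ) 2, E) := ContinuousLinearMap.const ℝ _
  have hcst : ∀ v ∈ Metric.ball (0 : E) (σ / 2), cst v ∈ Ψ.target := by
    intro v hv
    apply hΨt
    rw [mem_ball_zero_iff] at hv ⊢
    refine lt_of_le_of_lt ((ContinuousMap.norm_le _ (norm_nonneg v)).2 fun _ => le_rfl) ?_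
    linarith
  let W : E → C(Icc (-1 : ℝ) 2, E) := fun v => Ψ.symm (cst v)
  have hWs : ∀ v ∈ Metric.ball (0 : E) (σ / 2), W v ∈ Metric.ball (0 : C(Icc (-1 : ℝ) 2, E)) σ :=
    fun v hv => hΨs ▸ Ψ.map_target (hcst v hv)
  have hWF : ∀ v ∈ Metric.ball (0 : E) (σ / 2), F (W v) = cst v :=
    fun v hv => (hΨ _).symm.trans (Ψ.right_inv (hcst v hv))
  have hWuniq : ∀ v, ∀ w ∈ Metric.ball (0 : C(Icc (-1 : ℝ) 2, E)) σ, F w = cst v → W v = w := by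
    intro v w hw hFw
    change Ψ.symm (cst v) = w
    rw [← hFw, ← hΨ, Ψ.left_inv (hΨs ▸ hw)]
  have hWd : ContDiffOn ℝ 1 W (Metric.ball 0 (σ / 2)) :=
    hΨd.comp cst.contDiff.contDiffOn hcst
  have hW0 : W 0 = 0 := hWuniq 0 0 (Metric.mem_ball_self hσ) (by rw [hF0, map_zero])
  -- The exponential map at `p`.
  let ex : E → E := fun v => p + primitive (W v) ⟨1, m1⟩
  have hexd : ContDiffOn ℝ 1 ex (Metric.ball 0 (σ / 2)) := by
    have h := ((ContinuousMap.evalCLM ℝ (⟨1, m1⟩ : Icc (-1 : ℝ) 2)).comp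
      (primitive (E := E))).contDiff.comp_contDiffOn hWd (n := 1)
    exact contDiffOn_const.add h
  have hex0 : ex 0 = p := by
    simp only [ex, hW0, map_zero, ContinuousMap.zero_apply, add_zero]
  -- The error `W v - v` is controlled by the contraction estimate for `F`: a constant `1 / 4` for
  -- `F` gives `(1 / 4) / (1 - 1 / 4) = 1 / 3` for its inverse.
  have hexl : ∀ v₁ ∈ Metric.ball (0 : E) (σ / 2), ∀ v₂ ∈ Metric.ball (0 : E) (σ / 2),
      ‖ex v₁ - ex v₂ - (v₁ - v₂)‖ ≤ 1 / 3 * ‖v₁ - v₂‖ := by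
    intro v₁ h₁ v₂ h₂
    have a := hacc _ (hWs v₁ h₁) _ (hWs v₂ h₂)
    rw [hWF v₁ h₁, hWF v₂ h₂, ← map_sub] at a
    have b : ‖W v₁ - W v₂‖ ≤ ‖cst (v₁ - v₂)‖ + ‖cst (v₁ - v₂) - (W v₁ - W v₂)‖ :=
      norm_le_norm_add_norm_sub _ _
    have b' : ‖cst (v₁ - v₂)‖ ≤ ‖v₁ - v₂‖ :=
      (ContinuousMap.norm_le _ (norm_nonneg _)).2 fun _ => le_rfl
    have d : ‖primitive (W v₁ - W v₂ - cst (v₁ - v₂)) ⟨1, m1⟩‖ ≤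
        ‖W v₁ - W v₂ - cst (v₁ - v₂)‖ := by
      have := norm_integral_curveExtend_le (W v₁ - W v₂ - cst (v₁ - v₂)) 1
      rwa [abs_one, one_mul] at this
    have e : primitive (cst (v₁ - v₂)) ⟨1, m1⟩ = v₁ - v₂ := by
      have : curveExtend (cst (v₁ - v₂)) = fun _ => v₁ - v₂ := rfl
      rw [primitive_apply, this]
      simp
    have f : ex v₁ - ex v₂ - (v₁ - v₂) = primitive (W v₁ - W v₂ - cst (v₁ - v₂)) ⟨1, m1⟩ := by
      rw [map_sub, ContinuousMap.sub_apply, e, map_sub, ContinuousMap.sub_apply]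
      simp only [ex]
      abel
    rw [f]
    rw [norm_sub_rev] at d
    linarith
  obtain ⟨Θ, hΘs, hΘ, hΘt, hΘd⟩ := exists_openPartialHomeomorph_of_sub_id_lipschitz ex (σ / 2)
    (1 / 3) (by norm_num) (by norm_num) hexl hexd
  rw [hex0] at hΘt
  have hball : Metric.ball (0 : E) (σ / 6) ⊆ Θ.target := by
    refine fun q hq => hΘt ?_
    rw [mem_ball_zero_iff] at hq
    rw [Metric.mem_ball, dist_eq_norm]
    have := norm_sub_le q p
    linarith
  -- The geodesic with initial velocity `v`.
  have hgeo : ∀ v ∈ Metric.ball (0 : E) (σ / 2), ∃ x w : ℝ → E,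
      x 0 = p ∧ w 0 = v ∧ x 1 = ex v ∧
      (∀ t : ℝ, ∀ ht : t ∈ Icc (-1 : ℝ) 2, x t = p + primitive (W v) ⟨t, ht⟩) ∧
      ∀ t ∈ Ioo (-1 : ℝ) 2, ‖x t‖ < 3 * σ ∧
          HasDerivAt x (w t) t ∧ HasDerivAt w (-Γ (x t) (w t) (w t)) t := by
    intro v hv
    have hx : ∀ t : ℝ, ∀ ht : t ∈ Icc (-1 : ℝ) 2,
        p + curveExtend (primitive (W v)) t = p + primitive (W v) ⟨t, ht⟩ :=
      fun t ht => by rw [curveExtend_of_mem _ ht]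
    have hw : ∀ t : ℝ, curveExtend (W v) t =
        v - curveExtend (primitive (accelTerm Γ p (W v))) t := by
      intro t
      have h := DFunLike.congr_fun (hWF v hv) (projIcc (-1 : ℝ) 2 (by norm_num) t)
      exact eq_sub_of_add_eq h
    refine ⟨fun t => p + curveExtend (primitive (W v)) t, curveExtend (W v), ?_, ?_, ?_, hx, ?_⟩
    · change p + curveExtend (primitive (W v)) 0 = p
      rw [hx 0 m0, primitive_zero, add_zero]
    · rw [hw 0, curveExtend_of_mem _ m0, primitive_zero, sub_zero]
    · exact hx 1 m1
    · intro t ht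
      refine ⟨?_, (hasDerivAt_curveExtend_primitive (W v) ht).const_add p, ?_⟩
      · have h1 := norm_curveExtend_le (primitive (W v)) t
        have h2 := norm_primitive_le (W v)
        have h3 : ‖W v‖ < σ := mem_ball_zero_iff.1 (hWs v hv)
        have h4 := norm_add_le p (curveExtend (primitive (W v)) t)
        change ‖p + curveExtend (primitive (W v)) t‖ < 3 * σ
        linarith
      · have h := (hasDerivAt_curveExtend_primitive (accelTerm Γ p (W v)) ht).const_sub v
        have e : curveExtend (accelTerm Γ p (W v)) t =
            Γ (p + curveExtend (primitive (W v)) t) (curveExtend (W v) t)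
              (curveExtend (W v) t) := rfl
        rw [e] at h
        exact h.congr_of_eventuallyEq (Filter.Eventually.of_forall hw)
  -- The inverse image of the small ball is the star-shaped domain.
  let Θ' := Θ.trans (OpenPartialHomeomorph.ofSet (Metric.ball (0 : E) (σ / 6)) Metric.isOpen_ball)
  have hsrc : ∀ v, v ∈ Θ'.source ↔ v ∈ Metric.ball (0 : E) (σ / 2) ∧
      ex v ∈ Metric.ball (0 : E) (σ / 6) := by
    intro v
    simp only [Θ', OpenPartialHomeomorph.trans_source, OpenPartialHomeomorph.ofSet_source, hΘs,
      mem_inter_iff, mem_preimage, hΘ]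
  have htgt : Θ'.target = Metric.ball (0 : E) (σ / 6) := by
    simp only [Θ', OpenPartialHomeomorph.trans_target, OpenPartialHomeomorph.ofSet_target,
      OpenPartialHomeomorph.ofSet_symm, OpenPartialHomeomorph.ofSet_apply, preimage_id]
    exact inter_eq_left.2 hball
  have hcoe : ∀ v, Θ' v = ex v := fun v => hΘ v
  refine ⟨Θ', (hsrc 0).2 ⟨Metric.mem_ball_self (by linarith), by rwa [hex0]⟩, ?_, htgt, ?_, ?_, ?_⟩
  · rw [starConvex_zero_iff]
    intro v hv τ hτ0 hτ1
    obtain ⟨hv1, hv2⟩ := (hsrc v).1 hv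
    have hτ : τ ∈ Icc (0 : ℝ) 1 := ⟨hτ0, hτ1⟩
    have hτv : τ • v ∈ Metric.ball (0 : E) (σ / 2) := by
      rw [mem_ball_zero_iff] at hv1 ⊢
      rw [norm_smul, Real.norm_of_nonneg hτ0]
      exact (mul_le_of_le_one_left (norm_nonneg _) hτ1).trans_lt hv1
    refine (hsrc _).2 ⟨hτv, ?_⟩
    -- By homogeneity and uniqueness, the velocity curve of `τ • v` is that of `v`, rescaled.
    have hWτ : W (τ • v) = τ • (W v).comp (timeScale τ hτ) := by
      refine hWuniq _ _ ?_ ?_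
      · have h3 : ‖W v‖ < σ := mem_ball_zero_iff.1 (hWs v hv1)
        rw [mem_ball_zero_iff]
        refine lt_of_le_of_lt ((ContinuousMap.norm_le _ (norm_nonneg (W v))).2 fun t => ?_) h3
        rw [ContinuousMap.smul_apply, norm_smul, Real.norm_of_nonneg hτ0]
        exact (mul_le_of_le_one_left (norm_nonneg _) hτ1).trans ((W v).norm_coe_le_norm _)
      · rw [hFdef, geodesicOperator_timeScale, ← hFdef, hWF v hv1]
        rfl
    obtain ⟨x, w, hx0, -, hx1, hxt, hxw⟩ := hgeo v hv1
    have hτmem : τ ∈ Icc (-1 : ℝ) 2 := ⟨by linarith, by linarith⟩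
    have hexτ : ex (τ • v) = x τ := by
      rw [hxt τ hτmem]
      change p + primitive (W (τ • v)) ⟨1, m1⟩ = _
      rw [hWτ, primitive_smul_comp_timeScale]
      have : timeScale τ hτ ⟨1, m1⟩ = ⟨τ, hτmem⟩ := Subtype.ext (mul_one τ)
      rw [ContinuousMap.comp_apply, this]
    rw [hexτ, mem_ball_zero_iff]
    have hσC : 3 * σ * C ≤ 1 := by nlinarith [mul_nonneg hK (sq_nonneg σ)]
    refine norm_lt_of_hasDerivAt_accel hC hΓC hσC (fun t ht => (hxw t ht).1.le)
      (fun t ht => (hxw t ht).2.1) (fun t ht => (hxw t ht).2.2) ?_ ?_ hτ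
    · rwa [hx0]
    · rw [hx1]
      exact mem_ball_zero_iff.1 hv2
  · exact (hexd.mono fun v hv => ((hsrc v).1 hv).1).congr fun v _ => hcoe v
  · rw [htgt]
    exact hΘd.mono hball
  · intro v hv
    obtain ⟨x, w, hx0, hw0, hx1, -, hxw⟩ := hgeo v ((hsrc v).1 hv).1
    exact ⟨x, w, hx0, hw0, hx1.trans (hcoe v).symm, hxw⟩

end UniformExponential

/-! ### The Euler–Lagrange equation of the energy -/

section EulerLagrange

variable {E : Type*} [NormedAddCommGroup E] [NormedSpace ℝ E]

set_option synthInstance.maxHeartbeats 200000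

/-- The Euler–Lagrange expression of the energy `½ b(x)(x', x')` of a field `b` of bilinear forms,
for a curve with position `x`, velocity `w` and acceleration `a`, tested against `u`. -/
noncomputable def eulerLagrange (b : E → E →L[ℝ] E →L[ℝ] ℝ) (x w a u : E) : ℝ :=
  b x a u + fderiv ℝ b x w w u - 1 / 2 * fderiv ℝ b x u w w

theorem fderiv_apply_apply {b : E → E →L[ℝ] E →L[ℝ] ℝ} {x : E} (hb : DifferentiableAt ℝ b x)
    (h u v : E) : fderiv ℝ (fun z => b z u v) x h = fderiv ℝ b x h u v := by
  have h1 := (hb.hasFDerivAt.clm_apply (hasFDerivAt_const u x)).clm_apply (hasFDerivAt_const v x)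
  rw [h1.fderiv]
  simp

/-- The derivative of a pulled back field of bilinear forms. -/
theorem fderiv_pullback {b b' : E → E →L[ℝ] E →L[ℝ] ℝ} {ψ : E → E} {x : E}
    (hψ : ContDiffAt ℝ 2 ψ x) (hb : DifferentiableAt ℝ b x) (hb' : DifferentiableAt ℝ b' (ψ x))
    (h : ∀ᶠ z in nhds x, ∀ u v, b z u v = b' (ψ z) (fderiv ℝ ψ z u) (fderiv ℝ ψ z v))
    (d u v : E) :
    fderiv ℝ b x d u v =
      fderiv ℝ b' (ψ x) (fderiv ℝ ψ x d) (fderiv ℝ ψ x u) (fderiv ℝ ψ x v) +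
        b' (ψ x) (fderiv ℝ (fderiv ℝ ψ) x d u) (fderiv ℝ ψ x v) +
        b' (ψ x) (fderiv ℝ ψ x u) (fderiv ℝ (fderiv ℝ ψ) x d v) := by
  have hψ1 : HasFDerivAt ψ (fderiv ℝ ψ x) x := (hψ.differentiableAt two_ne_zero).hasFDerivAt
  have hψ2 : HasFDerivAt (fderiv ℝ ψ) (fderiv ℝ (fderiv ℝ ψ) x) x :=
    ((hψ.fderiv_right (m := 1) (by norm_num)).differentiableAt one_ne_zero).hasFDerivAt
  have hB : HasFDerivAt (fun z => b' (ψ z)) ((fderiv ℝ b' (ψ x)).comp (fderiv ℝ ψ x)) x :=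
    HasFDerivAt.comp (G := E →L[ℝ] E →L[ℝ] ℝ) (g := b') x hb'.hasFDerivAt hψ1
  have hu := hψ2.clm_apply (hasFDerivAt_const u x)
  have hv := hψ2.clm_apply (hasFDerivAt_const v x)
  have h1 := (hB.clm_apply hu).clm_apply hv
  rw [← fderiv_apply_apply hb, (h1.congr_of_eventuallyEq (h.mono fun z hz => hz u v)).fderiv]
  simp
  ring

/-- The Euler–Lagrange expression is a covector along the curve: it is compatible with changes of
coordinates. The second derivatives of the change of coordinates cancel by their symmetry. -/
theorem eulerLagrange_pullback {b b' : E → E →L[ℝ] E →L[ℝ] ℝ} {ψ : E → E} {x : E}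
    (hψ : ContDiffAt ℝ 2 ψ x) (hb : DifferentiableAt ℝ b x) (hb' : DifferentiableAt ℝ b' (ψ x))
    (hsymm : ∀ u v, b' (ψ x) u v = b' (ψ x) v u)
    (h : ∀ᶠ z in nhds x, ∀ u v, b z u v = b' (ψ z) (fderiv ℝ ψ z u) (fderiv ℝ ψ z v))
    (w a u : E) :
    eulerLagrange b x w a u = eulerLagrange b' (ψ x) (fderiv ℝ ψ x w)
      (fderiv ℝ (fderiv ℝ ψ) x w w + fderiv ℝ ψ x a) (fderiv ℝ ψ x u) := by
  have hs : IsSymmSndFDerivAt ℝ ψ x := hψ.isSymmSndFDerivAt (by simp)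
  rw [eulerLagrange, eulerLagrange, fderiv_pullback hψ hb hb' h, fderiv_pullback hψ hb hb' h,
    h.self_of_nhds a u, hs.eq u w, map_add, add_apply,
    hsymm (fderiv ℝ ψ x w) (fderiv ℝ (fderiv ℝ ψ) x w u)]
  ring

theorem hasDerivAt_comp_curve {ψ : E → E} {x w : ℝ → E} {t : ℝ} (hψ : ContDiffAt ℝ 2 ψ (x t))
    (hx : HasDerivAt x (w t) t) :
    HasDerivAt (fun s => ψ (x s)) (fderiv ℝ ψ (x t) (w t)) t :=
  (hψ.differentiableAt two_ne_zero).hasFDerivAt.comp_hasDerivAt t hx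

theorem hasDerivAt_fderiv_comp_curve {ψ : E → E} {x w : ℝ → E} {a : E} {t : ℝ}
    (hψ : ContDiffAt ℝ 2 ψ (x t)) (hx : HasDerivAt x (w t) t) (hw : HasDerivAt w a t) :
    HasDerivAt (fun s => fderiv ℝ ψ (x s) (w s))
      (fderiv ℝ (fderiv ℝ ψ) (x t) (w t) (w t) + fderiv ℝ ψ (x t) a) t := by
  have hψ2 : HasFDerivAt (fderiv ℝ ψ) (fderiv ℝ (fderiv ℝ ψ) (x t)) (x t) :=
    ((hψ.fderiv_right (m := 1) (by norm_num)).differentiableAt one_ne_zero).hasFDerivAt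
  exact (hψ2.comp_hasDerivAt t hx).clm_apply hw

end EulerLagrange

/-! ### Christoffel symbols and the Euler–Lagrange equation -/

section Coordinates

variable {m : ℕ}

set_option synthInstance.maxHeartbeats 200000

theorem euclideanSpace_eq_sum_single (w : EuclideanSpace ℝ (Fin m)) :
    w = ∑ i, w i • EuclideanSpace.single i (1 : ℝ) := by
  have := (EuclideanSpace.basisFun (Fin m) ℝ).sum_repr w
  simpa using this.symm

theorem clm_apply_eq_sum (B : EuclideanSpace ℝ (Fin m) →L[ℝ] ℝ) (w : EuclideanSpace ℝ (Fin m)) :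
    B w = ∑ i, w i * B (EuclideanSpace.single i (1 : ℝ)) := by
  conv_lhs => rw [euclideanSpace_eq_sum_single w]
  simp

theorem clm_apply_apply_eq_sum
    (B : EuclideanSpace ℝ (Fin m) →L[ℝ] EuclideanSpace ℝ (Fin m) →L[ℝ] ℝ)
    (w z : EuclideanSpace ℝ (Fin m)) :
    B w z = ∑ i, ∑ j, w i * z j *
      B (EuclideanSpace.single i (1 : ℝ)) (EuclideanSpace.single j (1 : ℝ)) := by
  conv_lhs => rw [euclideanSpace_eq_sum_single w]
  simp only [map_sum, map_smul, sum_apply, smul_apply, smul_eq_mul]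
  refine Finset.sum_congr rfl fun i _ => ?_
  rw [clm_apply_eq_sum, Finset.mul_sum]
  exact Finset.sum_congr rfl fun j _ => by ring

/-- Lowering the index of the geodesic expression `a^k + Γ^k_{ij} w^i w^j` yields the
Euler–Lagrange expression of the energy. -/
theorem mulVec_geodesic_eq_eulerLagrange
    (b : EuclideanSpace ℝ (Fin m) →
      EuclideanSpace ℝ (Fin m) →L[ℝ] EuclideanSpace ℝ (Fin m) →L[ℝ] ℝ)
    (y w a : EuclideanSpace ℝ (Fin m)) (A : Matrix (Fin m) (Fin m) ℝ)
    (hA : ∀ i j, A i j = b y (EuclideanSpace.single i (1 : ℝ)) (EuclideanSpace.single j (1 : ℝ)))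
    (hsymm : ∀ u v, b y u v = b y v u) (hdet : IsUnit A.det) (P : Fin m → Fin m → Fin m → ℝ)
    (hP : ∀ l i j, P l i j = fderiv ℝ b y (EuclideanSpace.single l (1 : ℝ))
      (EuclideanSpace.single i (1 : ℝ)) (EuclideanSpace.single j (1 : ℝ))) (l : Fin m) :
    A.mulVec (fun k => a k + ∑ i, ∑ j,
      (1 / 2 : ℝ) * (∑ l, A⁻¹ k l * (P i j l + P j i l - P l i j)) * w i * w j) l =
      eulerLagrange b y w a (EuclideanSpace.single l (1 : ℝ)) := by
  have hsplit : (fun k => a k + ∑ i, ∑ j,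
      (1 / 2 : ℝ) * (∑ l, A⁻¹ k l * (P i j l + P j i l - P l i j)) * w i * w j) =
      (fun k => a k) + A⁻¹.mulVec fun l => ∑ i, ∑ j, (1 / 2 : ℝ) *
        ((P i j l + P j i l - P l i j) * w i * w j) := by
    ext k
    simp only [Pi.add_apply, Matrix.mulVec, dotProduct, Finset.mul_sum, Finset.sum_mul]
    congr 1
    rw [Finset.sum_comm_cycle]
    exact Finset.sum_congr rfl fun l _ => Finset.sum_congr rfl fun i _ =>
      Finset.sum_congr rfl fun j _ => by ring
  have h1 : A.mulVec (fun k => a k) l = b y a (EuclideanSpace.single l (1 : ℝ)) := by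
    rw [hsymm, clm_apply_eq_sum]
    simp only [Matrix.mulVec, dotProduct, hA]
    exact Finset.sum_congr rfl fun i _ => mul_comm _ _
  have h2 : fderiv ℝ b y w w (EuclideanSpace.single l (1 : ℝ)) =
      ∑ i, ∑ j, w i * w j * P i j l := by
    conv_lhs => rw [euclideanSpace_eq_sum_single w]
    simp only [map_sum, map_smul, sum_apply, smul_apply, smul_eq_mul, Finset.mul_sum, ← hP]
    rw [Finset.sum_comm]
    exact Finset.sum_congr rfl fun i _ => Finset.sum_congr rfl fun j _ => by ring
  have h3 : fderiv ℝ b y (EuclideanSpace.single l (1 : ℝ)) w w =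
      ∑ i, ∑ j, w i * w j * P l i j := by
    rw [clm_apply_apply_eq_sum]
    simp only [hP]
  rw [hsplit, Matrix.mulVec_add, Matrix.mulVec_mulVec, Matrix.mul_nonsing_inv _ hdet,
    Matrix.one_mulVec, Pi.add_apply, h1, eulerLagrange, h2, h3]
  have h4 : ∑ i, ∑ j, w i * w j * P i j l = ∑ i, ∑ j, w i * w j * P j i l := by
    rw [Finset.sum_comm]
    exact Finset.sum_congr rfl fun i _ => Finset.sum_congr rfl fun j _ => by ring
  have h5 : ∑ i, ∑ j, (1 / 2 : ℝ) * ((P i j l + P j i l - P l i j) * w i * w j) =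
      1 / 2 * (∑ i, ∑ j, w i * w j * P i j l + ∑ i, ∑ j, w i * w j * P j i l -
        ∑ i, ∑ j, w i * w j * P l i j) := by
    simp only [← Finset.sum_add_distrib, ← Finset.sum_sub_distrib, Finset.mul_sum]
    exact Finset.sum_congr rfl fun i _ => Finset.sum_congr rfl fun j _ => by ring
  rw [h5, ← h4]
  ring

end Coordinates

/-! ### Bilinear forms with smooth values -/

section

variable {D E F : Type*} [NormedAddCommGroup D] [NormedSpace ℝ D] [NormedAddCommGroup E]
  [NormedSpace ℝ E] [FiniteDimensional ℝ E] [NormedAddCommGroup F] [NormedSpace ℝ F]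

set_option synthInstance.maxHeartbeats 200000

theorem contDiffOn_bilin_of_apply {n : WithTop ℕ∞} {b : D → E →L[ℝ] E →L[ℝ] F} {s : Set D}
    (h : ∀ u v, ContDiffOn ℝ n (fun y => b y u v) s) : ContDiffOn ℝ n b s := by
  have h1 : ∀ u, ContDiffOn ℝ n (fun y => b y u) s := fun u =>
    contDiffOn_clm_apply.2 fun v => h u v
  exact contDiffOn_clm_apply.2 h1

end

/-! ### The metric in a chart -/

section CoordForm

variable {m : ℕ} {M : Type*} [TopologicalSpace M] [ChartedSpace (EuclideanSpace ℝ (Fin m)) M]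

set_option synthInstance.maxHeartbeats 200000

/-- The derivative of the inverse of the chart `e`, with the tangent spaces of `M` identified with
the model space. -/
noncomputable def chartFrame (e : OpenPartialHomeomorph M (EuclideanSpace ℝ (Fin m)))
    (y : EuclideanSpace ℝ (Fin m)) :
    EuclideanSpace ℝ (Fin m) →L[ℝ] EuclideanSpace ℝ (Fin m) :=
  mfderiv (𝓡 m) (𝓡 m) e.symm y

/-- The field of bilinear forms `g` in the chart `e`, as a function on the model space. -/
noncomputable def coordForm (g : BilinField m M)
    (e : OpenPartialHomeomorph M (EuclideanSpace ℝ (Fin m))) (y : EuclideanSpace ℝ (Fin m)) :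
    EuclideanSpace ℝ (Fin m) →L[ℝ] EuclideanSpace ℝ (Fin m) →L[ℝ] ℝ :=
  ContinuousLinearMap.bilinearComp
    (show EuclideanSpace ℝ (Fin m) →L[ℝ] EuclideanSpace ℝ (Fin m) →L[ℝ] ℝ from g (e.symm y))
    (chartFrame e y) (chartFrame e y)

theorem coordForm_apply (g : BilinField m M)
    (e : OpenPartialHomeomorph M (EuclideanSpace ℝ (Fin m))) (y u v : EuclideanSpace ℝ (Fin m)) :
    coordForm g e y u v = g (e.symm y) (chartFrame e y u) (chartFrame e y v) := rfl

theorem metricMatrix_eq_coordForm (g : BilinField m M)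
    (e : OpenPartialHomeomorph M (EuclideanSpace ℝ (Fin m))) (y : EuclideanSpace ℝ (Fin m))
    (i j : Fin m) :
    metricMatrix g e y i j =
      coordForm g e y (EuclideanSpace.single i (1 : ℝ)) (EuclideanSpace.single j (1 : ℝ)) := rfl

theorem BilinField.apply_congr (g : BilinField m M) {p q : M} (h : p = q)
    (u v : EuclideanSpace ℝ (Fin m)) :
    (g p (show TangentSpace (𝓡 m) p from u) (show TangentSpace (𝓡 m) p from v) : ℝ) =
      g q (show TangentSpace (𝓡 m) q from u) (show TangentSpace (𝓡 m) q from v) := by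
  subst h
  rfl

theorem tangentBundle_mk_congr {p q : M} (h : p = q) {u v : EuclideanSpace ℝ (Fin m)}
    (huv : u = v) :
    (⟨p, show TangentSpace (𝓡 m) p from u⟩ : TangentBundle (𝓡 m) M) =
      ⟨q, show TangentSpace (𝓡 m) q from v⟩ := by
  subst h huv
  rfl

variable {e e' : OpenPartialHomeomorph M (EuclideanSpace ℝ (Fin m))}

theorem mdifferentiable_of_mem_maximalAtlas (he : e ∈ IsManifold.maximalAtlas (𝓡 m) ∞ M) :
    e.MDifferentiable (𝓡 m) (𝓡 m) :=
  ⟨(contMDiffOn_of_mem_maximalAtlas he).mdifferentiableOn (by simp),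
    (contMDiffOn_symm_of_mem_maximalAtlas he).mdifferentiableOn (by simp)⟩

theorem bijective_chartFrame (he : e ∈ IsManifold.maximalAtlas (𝓡 m) ∞ M)
    {y : EuclideanSpace ℝ (Fin m)} (hy : y ∈ e.target) : Function.Bijective (chartFrame e y) :=
  (mdifferentiable_of_mem_maximalAtlas he).symm.mfderiv_bijective (x := y) hy

theorem coordForm_symm {g : BilinField m M} (hg : IsPseudoRiemannianMetric g)
    (y u v : EuclideanSpace ℝ (Fin m)) : coordForm g e y u v = coordForm g e y v u :=
  hg.symm _ _ _

theorem coordForm_nondegenerate {g : BilinField m M} (hg : IsPseudoRiemannianMetric g)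
    (he : e ∈ IsManifold.maximalAtlas (𝓡 m) ∞ M) {y : EuclideanSpace ℝ (Fin m)}
    (hy : y ∈ e.target) {u : EuclideanSpace ℝ (Fin m)} (hu : ∀ v, coordForm g e y u v = 0) :
    u = 0 := by
  have hb := bijective_chartFrame he hy
  have h0 : chartFrame e y u = 0 := by
    refine hg.nondegenerate (e.symm y) (chartFrame e y u) fun w => ?_
    obtain ⟨v, rfl⟩ := hb.2 w
    exact hu v
  exact hb.1 (h0.trans (map_zero _).symm)

theorem isUnit_det_metricMatrix {g : BilinField m M} (hg : IsPseudoRiemannianMetric g)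
    (he : e ∈ IsManifold.maximalAtlas (𝓡 m) ∞ M) {y : EuclideanSpace ℝ (Fin m)}
    (hy : y ∈ e.target) : IsUnit (metricMatrix g e y).det := by
  rw [isUnit_iff_ne_zero]
  intro hdet
  obtain ⟨c, hc0, hc⟩ := Matrix.exists_mulVec_eq_zero_iff.2 hdet
  refine hc0 ?_
  have : WithLp.toLp 2 c = 0 := by
    refine coordForm_nondegenerate hg he hy fun v => ?_
    rw [clm_apply_eq_sum]
    refine Finset.sum_eq_zero fun l _ => ?_
    rw [coordForm_symm hg, clm_apply_eq_sum]
    have h := congrFun hc l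
    simp only [Matrix.mulVec, dotProduct, metricMatrix_eq_coordForm, Pi.zero_apply] at h
    rw [mul_eq_zero]
    right
    rw [← h]
    exact Finset.sum_congr rfl fun i _ => mul_comm _ _
  simpa using this

theorem contDiffAt_transition (he : e ∈ IsManifold.maximalAtlas (𝓡 m) ∞ M)
    (he' : e' ∈ IsManifold.maximalAtlas (𝓡 m) ∞ M) {y : EuclideanSpace ℝ (Fin m)}
    (hy : y ∈ e.target) (hy' : e.symm y ∈ e'.source) : ContDiffAt ℝ ∞ (fun z => e' (e.symm z)) y :=
  ((contMDiffAt_of_mem_maximalAtlas he' hy').comp y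
    (contMDiffAt_symm_of_mem_maximalAtlas he hy)).contDiffAt

theorem chartFrame_transition (he : e ∈ IsManifold.maximalAtlas (𝓡 m) ∞ M)
    (he' : e' ∈ IsManifold.maximalAtlas (𝓡 m) ∞ M) {y : EuclideanSpace ℝ (Fin m)}
    (hy : y ∈ e.target) (hy' : e.symm y ∈ e'.source) (u : EuclideanSpace ℝ (Fin m)) :
    chartFrame e y u =
      chartFrame e' (e' (e.symm y)) (fderiv ℝ (fun z => e' (e.symm z)) y u) := by
  have hψ : MDifferentiableAt (𝓡 m) (𝓡 m) (fun z => e' (e.symm z)) y :=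
    ((contDiffAt_transition he he' hy hy').differentiableAt (by simp)).mdifferentiableAt
  have h' := (mdifferentiable_of_mem_maximalAtlas he').mdifferentiableAt_symm
    (e'.map_source hy')
  have hev : (e.symm : EuclideanSpace ℝ (Fin m) → M) =ᶠ[nhds y]
      e'.symm ∘ fun z => e' (e.symm z) := by
    filter_upwards [(e.symm.continuousAt hy).eventually (e'.open_source.mem_nhds hy')] with z hz
    exact (e'.left_inv hz).symm
  have h1 : chartFrame e y =
      (mfderiv (𝓡 m) (𝓡 m) (e'.symm ∘ fun z => e' (e.symm z)) y :) := hev.mfderiv_eq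
  have h2 := mfderiv_comp y h' hψ
  rw [h1]
  rw [← mfderiv_eq_fderiv]
  exact DFunLike.congr_fun h2 u

/-- The forms of one metric in two charts are related by pull-back under the transition map. -/
theorem coordForm_transition (g : BilinField m M) (he : e ∈ IsManifold.maximalAtlas (𝓡 m) ∞ M)
    (he' : e' ∈ IsManifold.maximalAtlas (𝓡 m) ∞ M) {y : EuclideanSpace ℝ (Fin m)}
    (hy : y ∈ e.target) (hy' : e.symm y ∈ e'.source) (u v : EuclideanSpace ℝ (Fin m)) :
    coordForm g e y u v = coordForm g e' (e' (e.symm y))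
      (fderiv ℝ (fun z => e' (e.symm z)) y u) (fderiv ℝ (fun z => e' (e.symm z)) y v) := by
  rw [coordForm_apply, coordForm_apply, chartFrame_transition he he' hy hy' u,
    chartFrame_transition he he' hy hy' v]
  exact g.apply_congr (e'.left_inv hy').symm _ _

theorem bijective_fderiv_transition (he : e ∈ IsManifold.maximalAtlas (𝓡 m) ∞ M)
    (he' : e' ∈ IsManifold.maximalAtlas (𝓡 m) ∞ M) {y : EuclideanSpace ℝ (Fin m)}
    (hy : y ∈ e.target) (hy' : e.symm y ∈ e'.source) :
    Function.Bijective (fderiv ℝ (fun z => e' (e.symm z)) y) := by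
  have h1 := bijective_chartFrame he hy
  have h2 := bijective_chartFrame he' (e'.map_source hy')
  have h3 : (chartFrame e y : EuclideanSpace ℝ (Fin m) → EuclideanSpace ℝ (Fin m)) =
      chartFrame e' (e' (e.symm y)) ∘ fderiv ℝ (fun z => e' (e.symm z)) y :=
    funext fun u => chartFrame_transition he he' hy hy' u
  rw [h3] at h1
  exact h2.of_comp_iff' _ |>.1 h1

variable [IsManifold (𝓡 m) ∞ M]

/-- A `C²` family of metrics has jointly `C²` coefficients in every chart. -/
theorem contDiffOn_coordForm_apply {a : ℝ} {g : ℝ → BilinField m M}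
    (hg : IsC2PseudoRiemannianFamily a g) (he : e ∈ IsManifold.maximalAtlas (𝓡 m) ∞ M)
    (u v : EuclideanSpace ℝ (Fin m)) :
    ContDiffOn ℝ 2 (fun q : ℝ × EuclideanSpace ℝ (Fin m) => coordForm (g q.1) e q.2 u v)
      (Ioo (-a) a ×ˢ e.target) := by
  have hs : ContMDiffOn (𝓡 m) (𝓡 m) ∞ e.symm e.target := contMDiffOn_symm_of_mem_maximalAtlas he
  have hsnd : ContMDiffOn 𝓘(ℝ, ℝ × EuclideanSpace ℝ (Fin m)) (𝓡 m) 2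
      (fun q : ℝ × EuclideanSpace ℝ (Fin m) => e.symm q.2) (Ioo (-a) a ×ˢ e.target) :=
    (hs.of_le ENat.LEInfty.out).comp contDiff_snd.contMDiff.contMDiffOn fun q hq => hq.2
  have hpair : ContMDiffOn 𝓘(ℝ, ℝ × EuclideanSpace ℝ (Fin m)) (𝓘(ℝ, ℝ).prod (𝓡 m)) 2
      (fun q : ℝ × EuclideanSpace ℝ (Fin m) => (q.1, e.symm q.2)) (Ioo (-a) a ×ˢ e.target) :=
    contDiff_fst.contMDiff.contMDiffOn.prodMk hsnd
  have hG := hg.contMDiffOn.comp hpair fun q hq => ⟨hq.1, mem_univ _⟩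
  -- The coordinate vector fields are smooth sections of `TM` along `e.symm`.
  have hvec : ∀ u : EuclideanSpace ℝ (Fin m),
      ContMDiffOn 𝓘(ℝ, ℝ × EuclideanSpace ℝ (Fin m)) ((𝓡 m).prod (𝓡 m)) 2
      (fun q : ℝ × EuclideanSpace ℝ (Fin m) =>
        Bundle.TotalSpace.mk' (EuclideanSpace ℝ (Fin m)) (E := (TangentSpace (𝓡 m) : M → Type _))
          (e.symm q.2) (chartFrame e q.2 u)) (Ioo (-a) a ×ˢ e.target) := by
    intro u
    have h3 : (2 + 1 : WithTop ℕ∞) ≤ ∞ := by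
      rw [show (2 + 1 : WithTop ℕ∞) = 3 by norm_num]
      exact ENat.LEInfty.out
    have hT := hs.contMDiffOn_tangentMapWithin (m := 2) h3 e.open_target.uniqueMDiffOn
    have hc : ContMDiff (𝓡 m) ((𝓡 m).prod (𝓡 m)) 2 (fun z : EuclideanSpace ℝ (Fin m) =>
        (⟨z, u⟩ : TangentBundle (𝓡 m) (EuclideanSpace ℝ (Fin m)))) :=
      contMDiff_vectorSpace_iff_contDiff.2 contDiff_const
    have hc' : ContMDiffOn 𝓘(ℝ, ℝ × EuclideanSpace ℝ (Fin m)) ((𝓡 m).prod (𝓡 m)) 2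
        (fun q : ℝ × EuclideanSpace ℝ (Fin m) =>
          (⟨q.2, u⟩ : TangentBundle (𝓡 m) (EuclideanSpace ℝ (Fin m)))) (Ioo (-a) a ×ˢ e.target) :=
      (hc.comp contDiff_snd.contMDiff).contMDiffOn
    refine (hT.comp hc' fun q hq => hq.2).congr fun q hq => ?_
    change _ = tangentMapWithin (𝓡 m) (𝓡 m) e.symm e.target ⟨q.2, u⟩
    rw [tangentMapWithin_eq_tangentMap (e.open_target.uniqueMDiffOn _ hq.2)
      ((mdifferentiable_of_mem_maximalAtlas he).mdifferentiableAt_symm hq.2)]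
    rfl
  have key : ContMDiffOn 𝓘(ℝ, ℝ × EuclideanSpace ℝ (Fin m)) ((𝓡 m).prod 𝓘(ℝ, ℝ)) 2
      (fun q : ℝ × EuclideanSpace ℝ (Fin m) => Bundle.TotalSpace.mk' ℝ (E := Bundle.Trivial M ℝ)
        (e.symm q.2) (g q.1 (e.symm q.2) (chartFrame e q.2 u) (chartFrame e q.2 v)))
      (Ioo (-a) a ×ˢ e.target) :=
    ContMDiffOn.clm_bundle_apply₂ (F₁ := EuclideanSpace ℝ (Fin m))
      (F₂ := EuclideanSpace ℝ (Fin m)) hG (hvec u) (hvec v)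
  intro q hq
  have := key q hq
  simp only [Bundle.contMDiffWithinAt_totalSpace] at this
  exact this.2.contDiffWithinAt

theorem contDiffOn_coordForm {a : ℝ} {g : ℝ → BilinField m M}
    (hg : IsC2PseudoRiemannianFamily a g) (he : e ∈ IsManifold.maximalAtlas (𝓡 m) ∞ M) {ε : ℝ}
    (hε : ε ∈ Ioo (-a) a) : ContDiffOn ℝ 2 (coordForm (g ε) e) e.target := by
  have h : ∀ u v, ContDiffOn ℝ 2 (fun y => coordForm (g ε) e y u v) e.target := by
    intro u v
    have h2 : ContDiffOn ℝ 2 (fun y : EuclideanSpace ℝ (Fin m) => (ε, y)) e.target :=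
      contDiffOn_const.prodMk contDiffOn_id
    have h1 := contDiffOn_coordForm_apply hg he u v
    have hm : MapsTo (fun y : EuclideanSpace ℝ (Fin m) => (ε, y)) e.target
        (Ioo (-a) a ×ˢ e.target) := fun y hy => ⟨hε, hy⟩
    have h3 := h1.comp h2 hm
    exact h3
  exact contDiffOn_bilin_of_apply h

end CoordForm

/-! ### Geodesics in charts -/

section Geodesics

variable {m : ℕ} {M : Type*} [TopologicalSpace M] [ChartedSpace (EuclideanSpace ℝ (Fin m)) M]
  {e e' : OpenPartialHomeomorph M (EuclideanSpace ℝ (Fin m))} {g : BilinField m M}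

set_option synthInstance.maxHeartbeats 200000

theorem metricPartial_eq_fderiv_coordForm {y : EuclideanSpace ℝ (Fin m)}
    (hb : DifferentiableAt ℝ (coordForm g e) y) (l i j : Fin m) :
    metricPartial g e l i j y = fderiv ℝ (coordForm g e) y (EuclideanSpace.single l (1 : ℝ))
      (EuclideanSpace.single i (1 : ℝ)) (EuclideanSpace.single j (1 : ℝ)) :=
  fderiv_apply_apply hb _ _ _

/-- At a point of a chart, the geodesic equation with Christoffel symbols is equivalent to the
Euler–Lagrange equation of the energy. -/
theorem geodesic_equation_iff_eulerLagrange (hg : IsPseudoRiemannianMetric g)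
    (he : e ∈ IsManifold.maximalAtlas (𝓡 m) ∞ M) {y : EuclideanSpace ℝ (Fin m)}
    (hy : y ∈ e.target) (hb : DifferentiableAt ℝ (coordForm g e) y)
    (w a : EuclideanSpace ℝ (Fin m)) :
    (∀ k, a k + ∑ i, ∑ j, christoffel g e k i j y * w i * w j = 0) ↔
      ∀ u, eulerLagrange (coordForm g e) y w a u = 0 := by
  have hdet := isUnit_det_metricMatrix hg he hy
  have hmul := mulVec_geodesic_eq_eulerLagrange (coordForm g e) y w a (metricMatrix g e y)
    (fun i j => metricMatrix_eq_coordForm g e y i j) (coordForm_symm hg y) hdet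
    (fun l i j => metricPartial g e l i j y)
    fun l i j => metricPartial_eq_fderiv_coordForm hb l i j
  constructor
  · intro h
    have h0 : ∀ l, eulerLagrange (coordForm g e) y w a (EuclideanSpace.single l (1 : ℝ)) = 0 := by
      intro l
      have hz : (fun k => a k + ∑ i, ∑ j, christoffel g e k i j y * w i * w j) = 0 := funext h
      rw [← hmul l]
      exact (congrFun (congrArg _ hz) l).trans (by simp)
    intro u
    -- The Euler–Lagrange expression is linear in the test vector.
    have hlin : eulerLagrange (coordForm g e) y w a u =
        (coordForm g e y a + fderiv ℝ (coordForm g e) y w w -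
          (1 / 2 : ℝ) • ((fderiv ℝ (coordForm g e) y).flip w).flip w) u := by
      simp [eulerLagrange]
    rw [hlin, clm_apply_eq_sum]
    refine Finset.sum_eq_zero fun l _ => ?_
    have := h0 l
    simp only [eulerLagrange] at this
    simp only [add_apply, sub_apply, smul_apply, ContinuousLinearMap.flip_apply, smul_eq_mul, this,
      mul_zero]
  · intro h k
    have hz : (metricMatrix g e y).mulVec
        (fun k => a k + ∑ i, ∑ j, christoffel g e k i j y * w i * w j) = 0 :=
      funext fun l => (hmul l).trans (h _)
    have hinj := Matrix.mulVec_injective_of_isUnit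
      ((Matrix.isUnit_iff_isUnit_det _).2 hdet)
    exact congrFun (hinj (hz.trans (Matrix.mulVec_zero _).symm)) k

/-- Componentwise derivatives of a curve, as they appear in the geodesic equation. -/
theorem deriv_deriv_coord {y w : ℝ → EuclideanSpace ℝ (Fin m)} {a : EuclideanSpace ℝ (Fin m)}
    {t : ℝ} (hy : ∀ᶠ s in nhds t, HasDerivAt y (w s) s) (hw : HasDerivAt w a t) (k : Fin m) :
    deriv (fun s => y s k) t = w t k ∧ deriv (deriv fun s => y s k) t = a k := by
  have hc : ∀ {f : ℝ → EuclideanSpace ℝ (Fin m)} {f' : EuclideanSpace ℝ (Fin m)} {s : ℝ},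
      HasDerivAt f f' s → HasDerivAt (fun s => f s k) (f' k) s := fun h =>
    (EuclideanSpace.proj (𝕜 := ℝ) k).hasFDerivAt.comp_hasDerivAt _ h
  refine ⟨(hc hy.self_of_nhds).deriv, ?_⟩
  have : deriv (fun s => y s k) =ᶠ[nhds t] fun s => w s k := hy.mono fun s hs => (hc hs).deriv
  rw [this.deriv_eq]
  exact (hc hw).deriv

/-- A curve that solves the Euler–Lagrange equation of the energy in a single chart is a geodesic:
the equation then holds in every chart. -/
theorem isGeodesicOn_of_eulerLagrange [IsManifold (𝓡 m) ∞ M] (hg : IsPseudoRiemannianMetric g)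
    (hsm : ∀ e ∈ IsManifold.maximalAtlas (𝓡 m) ∞ M, ContDiffOn ℝ 2 (coordForm g e) e.target)
    (he : e ∈ IsManifold.maximalAtlas (𝓡 m) ∞ M) {x w a : ℝ → EuclideanSpace ℝ (Fin m)} {b c : ℝ}
    (hxt : ∀ t ∈ Ioo b c, x t ∈ e.target) (hx2 : ContDiffOn ℝ 2 x (Ioo b c))
    (hx : ∀ t ∈ Ioo b c, HasDerivAt x (w t) t) (hw : ∀ t ∈ Ioo b c, HasDerivAt w (a t) t)
    (hEL : ∀ t ∈ Ioo b c, ∀ u, eulerLagrange (coordForm g e) (x t) (w t) (a t) u = 0) :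
    IsGeodesicOn g (fun t => e.symm (x t)) b c := by
  have hdiff : ∀ e ∈ IsManifold.maximalAtlas (𝓡 m) ∞ M, ∀ y ∈ e.target,
      DifferentiableAt ℝ (coordForm g e) y := fun e he y hy =>
    ((hsm e he).contDiffAt (e.open_target.mem_nhds hy)).differentiableAt two_ne_zero
  refine ⟨((contMDiffOn_symm_of_mem_maximalAtlas he).of_le ENat.LEInfty.out).comp
    hx2.contMDiffOn hxt, ?_⟩
  intro t ht e' he' hsrc k
  set ψ : EuclideanSpace ℝ (Fin m) → EuclideanSpace ℝ (Fin m) := fun z => e' (e.symm z) with hψdef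
  have hψ : ∀ z ∈ e.target, e.symm z ∈ e'.source → ContDiffAt ℝ 2 ψ z := fun z hz hz' =>
    (contDiffAt_transition he he' hz hz').of_le ENat.LEInfty.out
  have hev : ∀ᶠ z in nhds (x t), z ∈ e.target ∧ e.symm z ∈ e'.source :=
    (e.open_target.eventually_mem (hxt t ht)).and
      ((e.symm.continuousAt (hxt t ht)).eventually (e'.open_source.mem_nhds hsrc))
  have hy : ∀ᶠ s in nhds t, HasDerivAt (fun s => ψ (x s)) (fderiv ℝ ψ (x s) (w s)) s := by
    filter_upwards [(hx t ht).continuousAt.eventually hev, Ioo_mem_nhds ht.1 ht.2] with s hs hs'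
    exact hasDerivAt_comp_curve (hψ _ hs.1 hs.2) (hx s hs')
  have hψt := hψ _ (hxt t ht) hsrc
  have hy' := hasDerivAt_fderiv_comp_curve hψt (hx t ht) (hw t ht)
  have hk := deriv_deriv_coord hy hy'
  have hEL' : ∀ u, eulerLagrange (coordForm g e') (ψ (x t)) (fderiv ℝ ψ (x t) (w t))
      (fderiv ℝ (fderiv ℝ ψ) (x t) (w t) (w t) + fderiv ℝ ψ (x t) (a t)) u = 0 := by
    intro u
    obtain ⟨u, rfl⟩ := (bijective_fderiv_transition he he' (hxt t ht) hsrc).2 u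
    have := eulerLagrange_pullback hψt (hdiff e he _ (hxt t ht))
      (hdiff e' he' _ (e'.map_source hsrc)) (coordForm_symm hg _)
      (hev.mono fun z hz u v => coordForm_transition g he he' hz.1 hz.2 u v) (w t) (a t) u
    rw [← this]
    exact hEL t ht u
  have := (geodesic_equation_iff_eulerLagrange hg he' (e'.map_source hsrc)
    (hdiff e' he' _ (e'.map_source hsrc)) _ _).2 hEL' k
  rw [(hk k).2]
  have hk1 : ∀ i, deriv (fun s => e' (e.symm (x s)) i) t = fderiv ℝ ψ (x t) (w t) i :=
    fun i => (hk i).1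
  simp only [hk1]
  exact this

end Geodesics

/-! ### Smoothness of inverse matrices -/

section MatrixSmooth

variable {D : Type*} [NormedAddCommGroup D] [NormedSpace ℝ D] {ι : Type*} [Fintype ι]
  [DecidableEq ι] {n : WithTop ℕ∞} {A : D → Matrix ι ι ℝ} {s : Set D}

theorem contDiffOn_det (hA : ∀ i j, ContDiffOn ℝ n (fun q => A q i j) s) :
    ContDiffOn ℝ n (fun q => (A q).det) s := by
  simp only [Matrix.det_apply']
  exact ContDiffOn.sum fun σ _ => contDiffOn_const.mul (contDiffOn_prod fun i _ => hA _ _)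

theorem contDiffOn_inv_matrix_apply (hA : ∀ i j, ContDiffOn ℝ n (fun q => A q i j) s)
    (hdet : ∀ q ∈ s, IsUnit (A q).det) (k l : ι) :
    ContDiffOn ℝ n (fun q => (A q)⁻¹ k l) s := by
  have h : ∀ q, (A q)⁻¹ k l = (A q).det⁻¹ * ((A q).updateRow l (Pi.single k 1)).det := by
    intro q
    rw [Matrix.inv_def, Matrix.smul_apply, Matrix.adjugate_apply, Ring.inverse_eq_inv', smul_eq_mul]
  simp only [h]
  refine ((contDiffOn_det hA).inv fun q hq => (hdet q hq).ne_zero).mul (contDiffOn_det fun i j => ?_)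
  by_cases hi : i = l
  · subst hi
    simp only [Matrix.updateRow_self]
    exact contDiffOn_const
  · simp only [Matrix.updateRow_ne hi]
    exact hA i j

end MatrixSmooth

/-! ### Christoffel symbols as a bilinear map -/

section ChristoffelMap

variable {m : ℕ} {M : Type*} [TopologicalSpace M] [ChartedSpace (EuclideanSpace ℝ (Fin m)) M]

set_option synthInstance.maxHeartbeats 200000

/-- The bilinear map `(v, w) ↦ v^i w^j e_k`. -/
noncomputable def elementaryBilin (k i j : Fin m) :
    EuclideanSpace ℝ (Fin m) →L[ℝ] EuclideanSpace ℝ (Fin m) →L[ℝ] EuclideanSpace ℝ (Fin m) :=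
  (EuclideanSpace.proj (𝕜 := ℝ) i).smulRight
    ((EuclideanSpace.proj (𝕜 := ℝ) j).smulRight (EuclideanSpace.single k (1 : ℝ)))

theorem elementaryBilin_apply (k i j : Fin m) (v w : EuclideanSpace ℝ (Fin m)) :
    elementaryBilin k i j v w = v i • w j • EuclideanSpace.single k (1 : ℝ) := rfl

/-- The Christoffel symbols of `g` in the chart `e`, as a bilinear map on the model space. -/
noncomputable def christoffelMap (g : BilinField m M)
    (e : OpenPartialHomeomorph M (EuclideanSpace ℝ (Fin m))) (y : EuclideanSpace ℝ (Fin m)) :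
    EuclideanSpace ℝ (Fin m) →L[ℝ] EuclideanSpace ℝ (Fin m) →L[ℝ] EuclideanSpace ℝ (Fin m) :=
  ∑ k, ∑ i, ∑ j, christoffel g e k i j y • elementaryBilin k i j

theorem christoffelMap_apply (g : BilinField m M)
    (e : OpenPartialHomeomorph M (EuclideanSpace ℝ (Fin m))) (y v w : EuclideanSpace ℝ (Fin m)) :
    christoffelMap g e y v w = ∑ k, ∑ i, ∑ j, christoffel g e k i j y •
      v i • w j • EuclideanSpace.single k (1 : ℝ) := by
  simp only [christoffelMap, sum_apply, smul_apply, elementaryBilin_apply]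

theorem christoffelMap_apply_coord (g : BilinField m M)
    (e : OpenPartialHomeomorph M (EuclideanSpace ℝ (Fin m))) (y v w : EuclideanSpace ℝ (Fin m))
    (k : Fin m) :
    christoffelMap g e y v w k = ∑ i, ∑ j, christoffel g e k i j y * v i * w j := by
  rw [christoffelMap_apply]
  simp only [← smul_assoc, ← Finset.sum_smul]
  simp [Pi.single_apply]

variable [IsManifold (𝓡 m) ∞ M] {e : OpenPartialHomeomorph M (EuclideanSpace ℝ (Fin m))}
  {a : ℝ} {g : ℝ → BilinField m M}

theorem contDiffOn_metricPartial (hg : IsC2PseudoRiemannianFamily a g)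
    (he : e ∈ IsManifold.maximalAtlas (𝓡 m) ∞ M) (l i j : Fin m) :
    ContDiffOn ℝ 1 (fun q : ℝ × EuclideanSpace ℝ (Fin m) => metricPartial (g q.1) e l i j q.2)
      (Ioo (-a) a ×ˢ e.target) := by
  have hopen : IsOpen (Ioo (-a) a ×ˢ e.target) := isOpen_Ioo.prod e.open_target
  intro q hq
  have h := (contDiffOn_coordForm_apply hg he (EuclideanSpace.single i (1 : ℝ))
    (EuclideanSpace.single j (1 : ℝ))).contDiffAt (hopen.mem_nhds hq)
  have h2 : ContDiffAt ℝ 2 (Function.uncurry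
      fun (q : ℝ × EuclideanSpace ℝ (Fin m)) (z : EuclideanSpace ℝ (Fin m)) =>
        metricMatrix (g q.1) e z i j) (q, q.2) := by
    have hf : ContDiffAt ℝ 2 (fun r : (ℝ × EuclideanSpace ℝ (Fin m)) × EuclideanSpace ℝ (Fin m) =>
        (r.1.1, r.2)) (q, q.2) := by fun_prop
    exact ContDiffAt.comp (q, q.2) h hf
  have h3 := ContDiffAt.fderiv h2 contDiffAt_snd (m := 1) (by norm_num)
  have h4 := h3.clm_apply (contDiffAt_const (c := EuclideanSpace.single l (1 : ℝ)))
  exact h4.contDiffWithinAt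

theorem contDiffOn_christoffel (hg : IsC2PseudoRiemannianFamily a g)
    (he : e ∈ IsManifold.maximalAtlas (𝓡 m) ∞ M) (k i j : Fin m) :
    ContDiffOn ℝ 1 (fun q : ℝ × EuclideanSpace ℝ (Fin m) => christoffel (g q.1) e k i j q.2)
      (Ioo (-a) a ×ˢ e.target) := by
  have hinv := contDiffOn_inv_matrix_apply (n := 1) (s := Ioo (-a) a ×ˢ e.target)
    (A := fun q : ℝ × EuclideanSpace ℝ (Fin m) => metricMatrix (g q.1) e q.2)
    (fun i j => (contDiffOn_coordForm_apply hg he (EuclideanSpace.single i (1 : ℝ))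
      (EuclideanSpace.single j (1 : ℝ))).of_le (by norm_num))
    fun q hq => isUnit_det_metricMatrix (hg.metric q.1 hq.1) he hq.2
  have hP := contDiffOn_metricPartial hg he
  exact contDiffOn_const.mul (ContDiffOn.sum fun l _ =>
    (hinv k l).mul (((hP i j l).add (hP j i l)).sub (hP l i j)))

theorem contDiffOn_christoffelMap (hg : IsC2PseudoRiemannianFamily a g)
    (he : e ∈ IsManifold.maximalAtlas (𝓡 m) ∞ M) :
    ContDiffOn ℝ 1 (fun q : ℝ × EuclideanSpace ℝ (Fin m) => christoffelMap (g q.1) e q.2)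
      (Ioo (-a) a ×ˢ e.target) := by
  have h : ∀ u v, ContDiffOn ℝ 1 (fun q : ℝ × EuclideanSpace ℝ (Fin m) =>
      christoffelMap (g q.1) e q.2 u v) (Ioo (-a) a ×ˢ e.target) := by
    intro u v
    simp only [christoffelMap_apply]
    exact ContDiffOn.sum fun k _ => ContDiffOn.sum fun i _ => ContDiffOn.sum fun j _ =>
      (contDiffOn_christoffel hg he k i j).smul contDiffOn_const
  exact contDiffOn_bilin_of_apply h

end ChristoffelMap

/-! ### Bump functions and uniform bounds -/

section Cutoff

variable {E F : Type*} [NormedAddCommGroup E] [NormedSpace ℝ E] [FiniteDimensional ℝ E]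
  [NormedAddCommGroup F] [NormedSpace ℝ F]

/-- A `C¹` family of compactly supported maps is bounded and Lipschitz, uniformly for parameters in
a compact set. -/
theorem exists_uniform_bound_lipschitz {O J : Set ℝ} (hO : IsOpen O) (hJ : IsCompact J)
    (hJO : J ⊆ O) {H : ℝ → E → F}
    (hH : ContDiffOn ℝ 1 (fun q : ℝ × E => H q.1 q.2) (O ×ˢ (univ : Set E)))
    {ρ : ℝ} (hsupp : ∀ ε z, ρ < ‖z‖ → H ε z = 0) :
    ∃ C K : ℝ, 0 ≤ C ∧ 0 ≤ K ∧ ∀ ε ∈ J, (∀ z, ‖H ε z‖ ≤ C) ∧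
      ∀ z z', ‖H ε z - H ε z'‖ ≤ K * ‖z - z'‖ := by
  have hopen : IsOpen (O ×ˢ (univ : Set E)) := hO.prod isOpen_univ
  have hcomp : IsCompact (J ×ˢ Metric.closedBall (0 : E) ρ) := hJ.prod (isCompact_closedBall _ _)
  have hat : ∀ q : ℝ × E, q.1 ∈ O → ContDiffAt ℝ 1 (fun q : ℝ × E => H q.1 q.2) q :=
    fun q hq => hH.contDiffAt (hopen.mem_nhds ⟨hq, mem_univ _⟩)
  have hder : ContinuousOn (fun q : ℝ × E => fderiv ℝ (H q.1) q.2) (O ×ˢ (univ : Set E)) := by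
    intro q hq
    have h2 : ContDiffAt ℝ 1 (Function.uncurry fun (q : ℝ × E) (z : E) => H q.1 z) (q, q.2) := by
      have hf : ContDiffAt ℝ 1 (fun r : (ℝ × E) × E => (r.1.1, r.2)) (q, q.2) := by fun_prop
      exact ContDiffAt.comp (q, q.2) (hat q hq.1) hf
    exact (ContDiffAt.fderiv h2 contDiffAt_snd (m := 0) (by norm_num)).continuousAt.continuousWithinAt
  have hsub : J ×ˢ Metric.closedBall (0 : E) ρ ⊆ O ×ˢ (univ : Set E) :=
    prod_mono hJO (subset_univ _)
  obtain ⟨C, hC⟩ := hcomp.exists_bound_of_continuousOn (hH.continuousOn.mono hsub)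
  obtain ⟨K, hK⟩ := hcomp.exists_bound_of_continuousOn (hder.mono hsub)
  refine ⟨max C 0, max K 0, le_max_right _ _, le_max_right _ _, fun ε hε => ⟨fun z => ?_, ?_⟩⟩
  · by_cases hz : ‖z‖ ≤ ρ
    · exact (hC (ε, z) ⟨hε, mem_closedBall_zero_iff.2 hz⟩).trans (le_max_left _ _)
    · rw [hsupp ε z (not_le.1 hz), norm_zero]
      exact le_max_right _ _
  · intro z z'
    have hd : ∀ z, DifferentiableAt ℝ (H ε) z := by
      intro z
      have h1 := (hat (ε, z) (hJO hε)).differentiableAt one_ne_zero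
      have h2 : DifferentiableAt ℝ (fun z : E => (ε, z)) z := by fun_prop
      have h3 := DifferentiableAt.comp (g := fun q : ℝ × E => H q.1 q.2) z h1 h2
      exact h3
    refine convex_univ.norm_image_sub_le_of_norm_fderiv_le (fun z _ => hd z) (fun z _ => ?_)
      (mem_univ z') (mem_univ z)
    by_cases hz : ‖z‖ ≤ ρ
    · exact (hK (ε, z) ⟨hε, mem_closedBall_zero_iff.2 hz⟩).trans (le_max_left _ _)
    · have : H ε =ᶠ[nhds z] fun _ => 0 := by
        filter_upwards [continuous_norm.continuousAt.eventually
          (lt_mem_nhds (not_le.1 hz))] with z' hz'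
        exact hsupp ε z' hz'
      rw [this.fderiv_eq, fderiv_fun_const]
      simp

theorem bump_smul_eq_zero (χ : ContDiffBump (0 : E)) {z : E} (hz : χ.rOut < ‖z‖) (y : F) :
    χ z • y = 0 := by
  rw [χ.zero_of_le_dist (by rw [dist_zero_right]; exact hz.le), zero_smul]

/-- Multiplication by a bump function extends a `C¹` family of maps, defined near a closed ball, to
a global one. -/
theorem contDiffOn_bump_smul {O : Set ℝ} (hO : IsOpen O) {T : Set E} (hT : IsOpen T) {y₀ : E}
    (χ : ContDiffBump (0 : E)) (hχ : ∀ z, ‖z‖ ≤ χ.rOut → y₀ + z ∈ T) {G : ℝ → E → F}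
    (hG : ContDiffOn ℝ 1 (fun q : ℝ × E => G q.1 q.2) (O ×ˢ T)) :
    ContDiffOn ℝ 1 (fun q : ℝ × E => χ q.2 • G q.1 (y₀ + q.2)) (O ×ˢ (univ : Set E)) := by
  intro q hq
  apply ContDiffAt.contDiffWithinAt
  by_cases hz : ‖q.2‖ ≤ χ.rOut
  · have h1 : ContDiffAt ℝ 1 (fun q : ℝ × E => G q.1 q.2) (q.1, y₀ + q.2) :=
      hG.contDiffAt ((hO.prod hT).mem_nhds ⟨hq.1, hχ _ hz⟩)
    have h2 : ContDiffAt ℝ 1 (fun q : ℝ × E => (q.1, y₀ + q.2)) q := by fun_prop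
    have h3 : ContDiffAt ℝ 1 (fun q : ℝ × E => G q.1 (y₀ + q.2)) q :=
      ContDiffAt.comp (g := fun q : ℝ × E => G q.1 q.2) q h1 h2
    have h4 : ContDiffAt ℝ 1 (fun q : ℝ × E => χ q.2) q :=
      (χ.contDiff.comp contDiff_snd).contDiffAt
    exact h4.smul h3
  · have : (fun q : ℝ × E => χ q.2 • G q.1 (y₀ + q.2)) =ᶠ[nhds q] fun _ => 0 := by
      filter_upwards [(continuous_norm.comp continuous_snd).continuousAt.eventually
        (lt_mem_nhds (not_le.1 hz))] with r hr
      exact bump_smul_eq_zero χ hr _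
    exact contDiffAt_const.congr_of_eventuallyEq this

end Cutoff

/-! ### Convex neighborhoods -/

section ConvexNeighborhood

set_option synthInstance.maxHeartbeats 200000

theorem contDiffOn_two_of_hasDerivAt {E : Type*} [NormedAddCommGroup E] [NormedSpace ℝ E]
    {x w a : ℝ → E} {s : Set ℝ} (hs : IsOpen s) (hx : ∀ t ∈ s, HasDerivAt x (w t) t)
    (hw : ∀ t ∈ s, HasDerivAt w (a t) t) (ha : ContinuousOn a s) : ContDiffOn ℝ 2 x s := by
  have hw1 : ContDiffOn ℝ 1 w s := by
    rw [show (1 : WithTop ℕ∞) = 0 + 1 by norm_num, contDiffOn_succ_iff_deriv_of_isOpen hs]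
    refine ⟨fun t ht => (hw t ht).differentiableAt.differentiableWithinAt, by simp, ?_⟩
    rw [contDiffOn_zero]
    exact ha.congr fun t ht => (hw t ht).deriv
  rw [show (2 : WithTop ℕ∞) = 1 + 1 by norm_num, contDiffOn_succ_iff_deriv_of_isOpen hs]
  exact ⟨fun t ht => (hx t ht).differentiableAt.differentiableWithinAt, by simp,
    hw1.congr fun t ht => (hx t ht).deriv⟩

variable {m : ℕ} {M : Type*} [TopologicalSpace M] [ChartedSpace (EuclideanSpace ℝ (Fin m)) M]
  [IsManifold (𝓡 m) ∞ M] {e : OpenPartialHomeomorph M (EuclideanSpace ℝ (Fin m))}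

/-- A solution of the geodesic equation in one chart is a geodesic, with the expected initial
velocity. -/
theorem isExp_of_coordinates {g : BilinField m M} (hg : IsPseudoRiemannianMetric g)
    (hsm : ∀ e ∈ IsManifold.maximalAtlas (𝓡 m) ∞ M, ContDiffOn ℝ 2 (coordForm g e) e.target)
    (he : e ∈ IsManifold.maximalAtlas (𝓡 m) ∞ M)
    (hΓ : ContinuousOn (christoffelMap g e) e.target) {p : M} (hp : p ∈ e.source)
    {x w : ℝ → EuclideanSpace ℝ (Fin m)} (hx0 : x 0 = e p)
    (hxt : ∀ t ∈ Ioo (-1 : ℝ) 2, x t ∈ e.target)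
    (hx : ∀ t ∈ Ioo (-1 : ℝ) 2, HasDerivAt x (w t) t)
    (hw : ∀ t ∈ Ioo (-1 : ℝ) 2, HasDerivAt w (-christoffelMap g e (x t) (w t) (w t)) t) :
    IsExp g p (show TangentSpace (𝓡 m) p from chartFrame e (e p) (w 0)) (e.symm (x 1)) := by
  have hxc : ContinuousOn x (Ioo (-1 : ℝ) 2) := fun t ht =>
    (hx t ht).continuousAt.continuousWithinAt
  have hwc : ContinuousOn w (Ioo (-1 : ℝ) 2) := fun t ht =>
    (hw t ht).continuousAt.continuousWithinAt
  have hac : ContinuousOn (fun t => -christoffelMap g e (x t) (w t) (w t)) (Ioo (-1 : ℝ) 2) :=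
    (((hΓ.comp hxc hxt).clm_apply hwc).clm_apply hwc).neg
  have hx2 := contDiffOn_two_of_hasDerivAt isOpen_Ioo hx hw hac
  have h0 : (0 : ℝ) ∈ Ioo (-1 : ℝ) 2 := by norm_num
  have hgeo : IsGeodesicOn g (fun t => e.symm (x t)) (-1) 2 := by
    refine isGeodesicOn_of_eulerLagrange hg hsm he hxt hx2 hx hw fun t ht => ?_
    refine (geodesic_equation_iff_eulerLagrange hg he (hxt t ht)
      (((hsm e he).contDiffAt (e.open_target.mem_nhds (hxt t ht))).differentiableAt
        two_ne_zero) _ _).1 fun k => ?_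
    rw [← christoffelMap_apply_coord]
    simp
  refine ⟨fun t => e.symm (x t), -1, 2, by norm_num, by norm_num, hgeo, ?_, rfl⟩
  have hmd : MDifferentiableAt (𝓡 m) (𝓡 m) e.symm (x 0) :=
    (mdifferentiable_of_mem_maximalAtlas he).mdifferentiableAt_symm (hxt 0 h0)
  have hd := mfderiv_comp (I := 𝓘(ℝ, ℝ)) 0 hmd (hx 0 h0).differentiableAt.mdifferentiableAt
  have hvel : (mfderiv 𝓘(ℝ, ℝ) (𝓡 m) (fun t => e.symm (x t)) 0 (1 : ℝ) :
      EuclideanSpace ℝ (Fin m)) = chartFrame e (e p) (w 0) := by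
    have h1 : (mfderiv 𝓘(ℝ, ℝ) (𝓡 m) x 0 (1 : ℝ) : EuclideanSpace ℝ (Fin m)) = w 0 := by
      rw [mfderiv_eq_fderiv]
      exact (fderiv_apply_one_eq_deriv).trans (hx 0 h0).deriv
    have h2 := DFunLike.congr_fun hd (1 : ℝ)
    refine h2.trans ?_
    rw [← h1, ← hx0]
    rfl
  exact tangentBundle_mk_congr ((congrArg e.symm hx0).trans (e.left_inv hp)) hvel

/-- A `C¹` exponential map in a chart yields a normal neighborhood in the manifold. -/
theorem isNormalNeighborhood_of_coordinates {g : BilinField m M} (hg : IsPseudoRiemannianMetric g)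
    (hsm : ∀ e ∈ IsManifold.maximalAtlas (𝓡 m) ∞ M, ContDiffOn ℝ 2 (coordForm g e) e.target)
    (he : e ∈ IsManifold.maximalAtlas (𝓡 m) ∞ M)
    (hΓ : ContinuousOn (christoffelMap g e) e.target) {p : M} {y₀ : EuclideanSpace ℝ (Fin m)}
    {r : ℝ} (hr : Metric.ball y₀ r ⊆ e.target)
    (hp : p ∈ e.source ∩ e ⁻¹' Metric.ball y₀ r)
    (Θ : OpenPartialHomeomorph (EuclideanSpace ℝ (Fin m)) (EuclideanSpace ℝ (Fin m)))
    (h0 : (0 : EuclideanSpace ℝ (Fin m)) ∈ Θ.source) (hstar : StarConvex ℝ 0 Θ.source)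
    (htgt : Θ.target = Metric.ball 0 r) (hΘ : ContDiffOn ℝ 1 Θ Θ.source)
    (hΘs : ContDiffOn ℝ 1 Θ.symm Θ.target)
    (hgeo : ∀ v ∈ Θ.source, ∃ x w : ℝ → EuclideanSpace ℝ (Fin m), x 0 = e p - y₀ ∧ w 0 = v ∧
      x 1 = Θ v ∧ ∀ t ∈ Ioo (-1 : ℝ) 2, y₀ + x t ∈ e.target ∧ HasDerivAt x (w t) t ∧
        HasDerivAt w (-christoffelMap g e (y₀ + x t) (w t) (w t)) t) :
    IsNormalNeighborhood g p (e.source ∩ e ⁻¹' Metric.ball y₀ r) := by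
  let A : EuclideanSpace ℝ (Fin m) ≃L[ℝ] EuclideanSpace ℝ (Fin m) :=
    (LinearEquiv.ofBijective (chartFrame e (e p)).toLinearMap
      (bijective_chartFrame he (e.map_source hp.1))).toContinuousLinearEquiv
  have hA : ∀ v, A v = chartFrame e (e p) v := fun _ => rfl
  have hball : ∀ v ∈ Θ.source, y₀ + Θ v ∈ Metric.ball y₀ r := by
    intro v hv
    have := Θ.map_source hv
    rw [htgt, mem_ball_zero_iff] at this
    rw [Metric.mem_ball, dist_eq_norm, add_sub_cancel_left]
    exact this
  have hball' : ∀ q ∈ e.source ∩ e ⁻¹' Metric.ball y₀ r, e q - y₀ ∈ Θ.target := by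
    intro q hq
    rw [htgt, mem_ball_zero_iff, ← dist_eq_norm]
    exact hq.2
  let Φ : PartialDiffeomorph (𝓡 m) (𝓡 m) (EuclideanSpace ℝ (Fin m)) M 1 :=
    { toFun := fun v => e.symm (y₀ + Θ (A.symm v))
      invFun := fun q => A (Θ.symm (e q - y₀))
      source := A.symm ⁻¹' Θ.source
      target := e.source ∩ e ⁻¹' Metric.ball y₀ r
      map_source' := fun v hv => by
        have h := hball _ hv
        refine ⟨e.map_target (hr h), ?_⟩
        rw [mem_preimage, e.right_inv (hr h)]
        exact h
      map_target' := fun q hq => by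
        rw [mem_preimage, A.symm_apply_apply]
        exact Θ.map_target (hball' q hq)
      left_inv' := fun v hv => by
        rw [e.right_inv (hr (hball _ hv)), add_sub_cancel_left, Θ.left_inv hv, A.apply_symm_apply]
      right_inv' := fun q hq => by
        rw [A.symm_apply_apply, Θ.right_inv (hball' q hq), add_sub_cancel, e.left_inv hq.1]
      open_source := Θ.open_source.preimage A.symm.continuous
      open_target := e.isOpen_inter_preimage Metric.isOpen_ball
      contMDiffOn_toFun := by
        have h1 : ContDiffOn ℝ 1 (fun v => y₀ + Θ (A.symm v)) (A.symm ⁻¹' Θ.source) :=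
          contDiffOn_const.add (hΘ.comp A.symm.contDiff.contDiffOn fun v hv => hv)
        exact ((contMDiffOn_symm_of_mem_maximalAtlas he).of_le ENat.LEInfty.out).comp
          h1.contMDiffOn fun v hv => hr (hball _ hv)
      contMDiffOn_invFun := by
        have h1 : ContDiffOn ℝ 1 (fun y => A (Θ.symm (y - y₀))) (Metric.ball y₀ r) := by
          refine A.contDiff.comp_contDiffOn (hΘs.comp (contDiff_id.sub contDiff_const).contDiffOn ?_)
          intro y hy
          rw [htgt, mem_ball_zero_iff]
          exact mem_ball_iff_norm.1 hy
        exact h1.contMDiffOn.comp (((contMDiffOn_of_mem_maximalAtlas he).of_le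
          ENat.LEInfty.out).mono inter_subset_left) fun q hq => hq.2 }
  refine ⟨hp, Φ, ?_, ?_, rfl, ?_⟩
  · change A.symm 0 ∈ Θ.source
    rwa [map_zero]
  · rw [starConvex_zero_iff] at hstar ⊢
    intro v hv τ hτ0 hτ1
    change A.symm (τ • v) ∈ Θ.source
    rw [map_smul]
    exact hstar hv hτ0 hτ1
  · intro v hv
    obtain ⟨x, w, hx0, hw0, hx1, hxw⟩ := hgeo (A.symm v) hv
    have := isExp_of_coordinates hg hsm he hΓ hp.1 (x := fun t => y₀ + x t) (w := w)
      (by rw [hx0, add_sub_cancel]) (fun t ht => (hxw t ht).1)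
      (fun t ht => (hxw t ht).2.1.const_add y₀) fun t ht => (hxw t ht).2.2
    rw [hx1, hw0, ← hA, A.apply_symm_apply] at this
    exact this

/-- In every chart, the small coordinate balls about a point are normal neighborhoods of each of
their points, with a radius that serves for a compact set of parameters. -/
theorem exists_ball_isNormalNeighborhood {a : ℝ} {g : ℝ → BilinField m M}
    (hg : IsC2PseudoRiemannianFamily a g) (he : e ∈ IsManifold.maximalAtlas (𝓡 m) ∞ M)
    {y₀ : EuclideanSpace ℝ (Fin m)} (hy₀t : y₀ ∈ e.target) {J : Set ℝ} (hJc : IsCompact J)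
    (hJ : J ⊆ Ioo (-a) a) :
    ∃ r : ℝ, 0 < r ∧ ∀ ε ∈ J, ∀ p ∈ e.source ∩ e ⁻¹' Metric.ball y₀ r,
      IsNormalNeighborhood (g ε) p (e.source ∩ e ⁻¹' Metric.ball y₀ r) := by
  obtain ⟨R, hR, hRt⟩ := Metric.nhds_basis_closedBall.mem_iff.1 (e.open_target.mem_nhds hy₀t)
  have hRt' : ∀ z : EuclideanSpace ℝ (Fin m), ‖z‖ ≤ R → y₀ + z ∈ e.target := fun z hz =>
    hRt (by rwa [Metric.mem_closedBall, dist_eq_norm, add_sub_cancel_left])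
  let χ : ContDiffBump (0 : EuclideanSpace ℝ (Fin m)) := ⟨R / 2, R, by linarith, by linarith⟩
  have hsmooth := contDiffOn_bump_smul isOpen_Ioo e.open_target χ (y₀ := y₀) hRt'
    (G := fun ε y => christoffelMap (g ε) e y) (contDiffOn_christoffelMap hg he)
  obtain ⟨C, K, hC, hK, hbound⟩ := exists_uniform_bound_lipschitz isOpen_Ioo hJc hJ
    (H := fun ε z => χ z • christoffelMap (g ε) e (y₀ + z)) hsmooth (ρ := R)
    fun ε z hz => bump_smul_eq_zero (F := EuclideanSpace ℝ (Fin m) →L[ℝ]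
      EuclideanSpace ℝ (Fin m) →L[ℝ] EuclideanSpace ℝ (Fin m)) χ hz _
  -- The scale on which the geodesic equation is a small perturbation of `x'' = 0`.
  obtain ⟨σ, hσ, hσR, hsmall⟩ : ∃ σ : ℝ, 0 < σ ∧ 3 * σ ≤ R / 2 ∧
      2 * (2 * K * σ ^ 2 + 2 * C * σ) ≤ 1 / 4 := by
    have hpos : 0 < 16 * (K + C + 1) := by positivity
    refine ⟨min 1 (min (R / 6) (1 / (16 * (K + C + 1)))), by positivity, ?_, ?_⟩
    · have h1 := min_le_right (1 : ℝ) (min (R / 6) (1 / (16 * (K + C + 1))))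
      have h2 := min_le_left (R / 6) (1 / (16 * (K + C + 1)))
      linarith
    · set σ := min 1 (min (R / 6) (1 / (16 * (K + C + 1)))) with hσdef
      have h1 : σ ≤ 1 := min_le_left _ _
      have h2 : σ ≤ 1 / (16 * (K + C + 1)) := (min_le_right _ _).trans (min_le_right _ _)
      have h0 : 0 < σ := by positivity
      have h3 : σ * (16 * (K + C + 1)) ≤ 1 := (le_div_iff₀ hpos).1 h2
      nlinarith [mul_nonneg hK h0.le, mul_nonneg (mul_nonneg hK h0.le) (sub_nonneg.2 h1)]
  have hballt : Metric.ball y₀ (σ / 6) ⊆ e.target := fun y hy =>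
    hRt (Metric.mem_closedBall.2 ((Metric.mem_ball.1 hy).le.trans (by linarith)))
  refine ⟨σ / 6, by linarith, fun ε hε p hp => ?_⟩
  have hε' := hJ hε
  have hcd : ContDiff ℝ 1 fun z => χ z • christoffelMap (g ε) e (y₀ + z) := by
    have h1 : ContDiffOn ℝ 1 (fun z : EuclideanSpace ℝ (Fin m) => (ε, z)) univ :=
      contDiffOn_const.prodMk contDiffOn_id
    have h2 := hsmooth.comp h1 fun z _ => ⟨hε', mem_univ z⟩
    exact contDiffOn_univ.1 h2
  have hΓc : ContinuousOn (christoffelMap (g ε) e) e.target := by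
    have h1 : ContinuousOn (fun z : EuclideanSpace ℝ (Fin m) => (ε, z)) e.target :=
      continuousOn_const.prodMk continuousOn_id
    have h2 := (contDiffOn_christoffelMap hg he).continuousOn.comp h1 fun z hz => ⟨hε', hz⟩
    exact h2
  obtain ⟨Θ, h0, hstar, htgt, hΘ, hΘs, hgeo⟩ := exists_exponential_of_small
    ⟨fun z => χ z • christoffelMap (g ε) e (y₀ + z), hcd.continuous⟩ hcd hC hK
    (hbound ε hε).1 (hbound ε hε).2 hσ hsmall (e p - y₀)
    (by rw [mem_ball_zero_iff]; exact mem_ball_iff_norm.1 hp.2)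
  refine isNormalNeighborhood_of_coordinates (hg.metric ε hε')
    (fun e he => contDiffOn_coordForm hg he hε') he hΓc hballt hp Θ h0 hstar htgt hΘ hΘs ?_
  intro v hv
  obtain ⟨x, w, hx0, hw0, hx1, hxw⟩ := hgeo v hv
  refine ⟨x, w, hx0, hw0, hx1, fun t ht => ?_⟩
  obtain ⟨hn, hx, hw⟩ := hxw t ht
  refine ⟨hRt' _ (by linarith), hx, ?_⟩
  -- The geodesic stays in the region where the bump function equals `1`.
  have hχ : χ (x t) = 1 := χ.one_of_mem_closedBall
    (by rw [mem_closedBall_zero_iff]; change ‖x t‖ ≤ R / 2; linarith)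
  have hval : (χ (x t) • christoffelMap (g ε) e (y₀ + x t)) =
      christoffelMap (g ε) e (y₀ + x t) := by rw [hχ, one_smul]
  rw [← hval]
  exact hw

end ConvexNeighborhood

theorem mainTheorem5 {m : ℕ} {M : Type*} [TopologicalSpace M] [T2Space M]
    [ChartedSpace (EuclideanSpace ℝ (Fin m)) M] [IsManifold (𝓡 m) ∞ M]
    (a : ℝ) (g : ℝ → BilinField m M) (hg : IsC2PseudoRiemannianFamily a g)
    (p₀ : M) (ε₀ : ℝ) (hε₀ : ε₀ ∈ Ioo 0 a) :
    ∃ U : Set M, p₀ ∈ U ∧ ∀ ε ∈ Icc (-ε₀) ε₀, IsGeodesicallyConvex (g ε) U := by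
  set e := chartAt (EuclideanSpace ℝ (Fin m)) p₀
  have he : e ∈ IsManifold.maximalAtlas (𝓡 m) ∞ M := IsManifold.chart_mem_maximalAtlas p₀
  have hp₀ : p₀ ∈ e.source := mem_chart_source _ p₀
  have hJ : Icc (-ε₀) ε₀ ⊆ Ioo (-a) a := fun ε hε =>
    ⟨by linarith [hε.1, hε₀.2], by linarith [hε.2, hε₀.2]⟩
  obtain ⟨r, hr, h⟩ := exists_ball_isNormalNeighborhood hg he (e.map_source hp₀) isCompact_Icc hJ
  exact ⟨e.source ∩ e ⁻¹' Metric.ball (e p₀) r, ⟨hp₀, Metric.mem_ball_self hr⟩, fun ε hε =>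
    ⟨e.isOpen_inter_preimage Metric.isOpen_ball, h ε hε⟩⟩
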